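/- Let $p\geqslant 1$, $m\geqslant 1$ and $n$ be integers such that either $m\geqslant 2$ and $0\leqslant n\leqslant 3$, or $m=1$ and $n\in\mathbb N$ is arbitrary. Let $F\colon\mathbb R^p\to\mathbb C$ be of class $C^\infty$ on $\mathbb R^p\setminus\{0\}$ and homogeneous of degree $m$ in the sense that $$F(\lambda y)=\lambda^m F(y)\qquad\text{for all }\lambda\geqslant 0\text{ and all }y\in\mathbb R^p .$$ For $f\in L^2(\mathbb R^n)$ with values in a finite-dimensional space, write $f\in H^m(\mathbb R^n)$ if $(1+|\xi|^2)^{m/2}\widehat f\in L^2(\mathbb R^n)$, where $\widehat f(\xi)=\int_{\mathbb{R}^n} e^{-2\pi i x\cdot\xi}f(x)\,dx$ (extended to $L^2$), and put $\|f\|_{H^m}=\|(1+|\xi|^2)^{m/2}\widehat f\|_{L^2}$. Then there exists a constant $K>0$, depending only on $F$, $m$, $n$ and $p$, such that for every $u\in H^m(\mathbb R^n)$ with values in $\mathbb R^p$ one has $F(u)\in H^m(\mathbb R^n)$ and $$\|F(u)\|_{H^m}\leqslant K\,\|u\|_{H^m}^m .$$ -/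

import Mathlib

open MeasureTheory
open scoped ContDiff SchwartzMap

/-- `f ∈ H^m(ℝⁿ; V)`: `f` is square integrable and the tempered distribution it defines belongs to
the `L²`-based Sobolev space of order `m`, i.e. `𝓕⁻¹ (1 + |ξ|²)^(m/2) 𝓕 f ∈ L²`. -/
def MemH {n : ℕ} {V : Type*} [NormedAddCommGroup V] [NormedSpace ℂ V] [CompleteSpace V]
    (m : ℕ) (f : EuclideanSpace ℝ (Fin n) → V) : Prop :=
  ∃ hf : MemLp f 2 (volume : Measure (EuclideanSpace ℝ (Fin n))),
    TemperedDistribution.MemSobolev (m : ℝ) 2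
      ((hf.toLp f : Lp V 2 (volume : Measure (EuclideanSpace ℝ (Fin n)))) :
        𝓢'(EuclideanSpace ℝ (Fin n), V))

/-- The norm of `H^m(ℝⁿ; V)`: the `L²` norm of `g = 𝓕⁻¹ (1 + |ξ|²)^(m/2) 𝓕 f`. For `f ∈ H^m` there
is exactly one such `g` in `L²` (see `normH_eq`), so the infimum is over a one-point set. -/
noncomputable def normH {n : ℕ} {V : Type*} [NormedAddCommGroup V] [NormedSpace ℂ V]
    [CompleteSpace V] (m : ℕ) (f : EuclideanSpace ℝ (Fin n) → V) : ℝ :=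
  sInf {r : ℝ | ∃ (hf : MemLp f 2 (volume : Measure (EuclideanSpace ℝ (Fin n))))
    (g : Lp V 2 (volume : Measure (EuclideanSpace ℝ (Fin n)))),
    TemperedDistribution.besselPotential (EuclideanSpace ℝ (Fin n)) V (m : ℝ)
      ((hf.toLp f : Lp V 2 (volume : Measure (EuclideanSpace ℝ (Fin n)))) :
        𝓢'(EuclideanSpace ℝ (Fin n), V)) = (g : 𝓢'(EuclideanSpace ℝ (Fin n), V)) ∧ r = ‖g‖}

theorem normH_eq {n : ℕ} {V : Type*} [NormedAddCommGroup V] [NormedSpace ℂ V] [CompleteSpace V]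
    (m : ℕ) (f : EuclideanSpace ℝ (Fin n) → V)
    (hf : MemLp f 2 (volume : Measure (EuclideanSpace ℝ (Fin n))))
    (g : Lp V 2 (volume : Measure (EuclideanSpace ℝ (Fin n))))
    (h : TemperedDistribution.besselPotential (EuclideanSpace ℝ (Fin n)) V (m : ℝ)
      ((hf.toLp f : Lp V 2 (volume : Measure (EuclideanSpace ℝ (Fin n)))) :
        𝓢'(EuclideanSpace ℝ (Fin n), V)) = (g : 𝓢'(EuclideanSpace ℝ (Fin n), V))) :
    normH m f = ‖g‖ := by
  have key : ∀ g' : Lp V 2 (volume : Measure (EuclideanSpace ℝ (Fin n))),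
      (g : 𝓢'(EuclideanSpace ℝ (Fin n), V)) = (g' : 𝓢'(EuclideanSpace ℝ (Fin n), V)) →
      g = g' := by
    intro g' hg
    have hinj := LinearMap.ker_eq_bot.mp
      (Lp.ker_toTemperedDistributionCLM_eq_bot (E := EuclideanSpace ℝ (Fin n)) (F := V)
        (μ := (volume : Measure (EuclideanSpace ℝ (Fin n)))) (p := 2))
    exact hinj hg
  have hset : {r : ℝ | ∃ (hf : MemLp f 2 (volume : Measure (EuclideanSpace ℝ (Fin n))))
      (g : Lp V 2 (volume : Measure (EuclideanSpace ℝ (Fin n)))),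
      TemperedDistribution.besselPotential (EuclideanSpace ℝ (Fin n)) V (m : ℝ)
        ((hf.toLp f : Lp V 2 (volume : Measure (EuclideanSpace ℝ (Fin n)))) :
          𝓢'(EuclideanSpace ℝ (Fin n), V)) = (g : 𝓢'(EuclideanSpace ℝ (Fin n), V)) ∧
        r = ‖g‖} = {‖g‖} := by
    ext r
    constructor
    · rintro ⟨hf', g', hg', rfl⟩
      rw [key g' (h.symm.trans hg')]
      rfl
    · rintro rfl
      exact ⟨hf, g, h, rfl⟩
  rw [normH, hset, csInf_singleton]

/-- An `ℝᵖ`-valued function regarded as a `ℂᵖ`-valued one (coordinatewise, so that the Euclidean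
norms agree). -/
noncomputable def complexify {n p : ℕ}
    (u : EuclideanSpace ℝ (Fin n) → EuclideanSpace ℝ (Fin p)) :
    EuclideanSpace ℝ (Fin n) → EuclideanSpace ℂ (Fin p) :=
  fun x => WithLp.toLp 2 (fun i => ((u x i : ℝ) : ℂ))

/-!
The estimate is proved for Schwartz `u` and extended by density. Multiplying `F` by a cutoff that
vanishes near the origin gives a smooth `H` with `‖Dʲ H(y)‖ ≤ C ‖y‖ ^ (m - j)` for `j ≤ m`, and the
rescalings `t ^ (-m) H(t y)` obey the same bounds and tend to `F` as `t → ∞`; so it suffices to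
bound `G ∘ u` for `G` with these bounds. By Faà di Bruno, `Dᵐ (G ∘ u)` is a sum of products of
derivatives of `u` whose orders add up to `m`. When `m ≥ 2` and `n ≤ 3`, Cauchy–Schwarz on the
Fourier side bounds the derivatives of order at most `m - 2` in `L^∞`, because
`(1 + |ξ|²)⁻¹ ∈ L²`; hence every factor but one is bounded and the last one is in `L²`. The only
exception is the product of two first derivatives for `m = 2`, where integration by parts gives
`‖∂u‖²_{L⁴} ≤ 3 ‖u‖_{L^∞} ‖∂²u‖_{L²}` for each component. In the limit, the
weighted `L²` bound survives by Fatou's lemma on the Fourier side.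
-/

open Filter FourierTransform LineDeriv
open scoped ENNReal Topology

section FourierMultiplier

open SchwartzMap

variable {E V : Type*} [NormedAddCommGroup E] [InnerProductSpace ℝ E]

theorem hasTemperateGrowth_prod_inner {j : ℕ} (v : Fin j → E) :
    (fun ξ : E => ∏ i, inner ℝ ξ (v i)).HasTemperateGrowth := by
  induction j with
  | zero => simp only [Finset.univ_eq_empty, Finset.prod_empty, Function.HasTemperateGrowth.const]
  | succ j ih =>
    simp only [Fin.prod_univ_succ]
    have := ih fun i => v i.succ
    fun_prop

variable [FiniteDimensional ℝ E] [MeasurableSpace E] [BorelSpace E] [NormedAddCommGroup V]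

theorem ofReal_norm_schwartz_toLp [NormedSpace ℝ V] (f : 𝓢(E, V)) (p : ℝ≥0∞) :
    ENNReal.ofReal ‖f.toLp p‖ = eLpNorm f p volume := by
  rw [norm_toLp, ENNReal.ofReal_toReal (f.eLpNorm_lt_top p volume).ne]

theorem enorm_fourierInv_schwartz_apply_le [NormedSpace ℂ V] (f : 𝓢(E, V)) (x : E) :
    ‖(𝓕⁻ f : 𝓢(E, V)) x‖ₑ ≤ eLpNorm f 1 volume := by
  rw [fourierInv_apply_eq, ← ofReal_norm, ← ofReal_norm_schwartz_toLp]
  exact ENNReal.ofReal_le_ofReal (norm_fourier_apply_le_toLp_one f (-x))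

variable [InnerProductSpace ℂ V] [CompleteSpace V]

theorem eLpNorm_fourier_schwartz_two (f : 𝓢(E, V)) :
    eLpNorm (𝓕 f : 𝓢(E, V)) 2 volume = eLpNorm f 2 volume := by
  rw [← ofReal_norm_schwartz_toLp, ← ofReal_norm_schwartz_toLp, norm_fourier_toL2_eq]

variable {σ : E → ℝ} (hσ : σ.HasTemperateGrowth)
include hσ

theorem fourier_fourierMultiplierCLM_apply (g : 𝓢(E, V)) (ξ : E) :
    (𝓕 (fourierMultiplierCLM V σ g) : 𝓢(E, V)) ξ = σ ξ • (𝓕 g : 𝓢(E, V)) ξ := by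
  rw [fourierMultiplierCLM_apply, FourierTransform.fourier_fourierInv_eq,
    smulLeftCLM_apply_apply hσ]

theorem eLpNorm_fourierMultiplierCLM_two_le {C : ℝ} (hC : ∀ ξ, |σ ξ| ≤ C) (g : 𝓢(E, V)) :
    eLpNorm (fourierMultiplierCLM V σ g) 2 volume ≤ ENNReal.ofReal C * eLpNorm g 2 volume := by
  rw [← eLpNorm_fourier_schwartz_two, ← eLpNorm_fourier_schwartz_two g]
  refine eLpNorm_le_mul_eLpNorm_of_ae_le_mul (Eventually.of_forall fun ξ => ?_) 2
  rw [fourier_fourierMultiplierCLM_apply hσ, norm_smul, Real.norm_eq_abs]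
  gcongr
  exact hC ξ

theorem enorm_fourierMultiplierCLM_apply_le (g : 𝓢(E, V)) (x : E) :
    ‖fourierMultiplierCLM V σ g x‖ₑ ≤ eLpNorm σ 2 volume * eLpNorm g 2 volume := by
  have hsmul : ⇑(smulLeftCLM V σ (𝓕 g : 𝓢(E, V))) = σ • ⇑(𝓕 g : 𝓢(E, V)) := by
    ext ξ
    exact smulLeftCLM_apply_apply hσ _ ξ
  calc ‖fourierMultiplierCLM V σ g x‖ₑ
      ≤ eLpNorm (σ • ⇑(𝓕 g : 𝓢(E, V))) 1 volume := by
        rw [fourierMultiplierCLM_apply, ← hsmul]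
        exact enorm_fourierInv_schwartz_apply_le _ x
    _ ≤ eLpNorm σ 2 volume * eLpNorm (𝓕 g : 𝓢(E, V)) 2 volume :=
        eLpNorm_smul_le_mul_eLpNorm (𝓕 g : 𝓢(E, V)).continuous.aestronglyMeasurable
          hσ.1.continuous.aestronglyMeasurable
    _ = eLpNorm σ 2 volume * eLpNorm g 2 volume := by rw [eLpNorm_fourier_schwartz_two]

theorem norm_fourierMultiplierCLM_apply_le (hσ2 : MemLp σ 2 volume) (g : 𝓢(E, V)) (x : E) :
    ‖fourierMultiplierCLM V σ g x‖ ≤ (eLpNorm σ 2 volume).toReal * ‖g.toLp 2‖ := by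
  have h := ENNReal.toReal_mono
    (ENNReal.mul_ne_top hσ2.2.ne (g.eLpNorm_lt_top 2 volume).ne)
    (enorm_fourierMultiplierCLM_apply_le hσ g x)
  rwa [toReal_enorm, ENNReal.toReal_mul, ← norm_toLp] at h

theorem iteratedLineDerivOp_fourierMultiplierCLM (g : 𝓢(E, V)) {j : ℕ} (v : Fin j → E) :
    ∂^{v} (fourierMultiplierCLM V σ g) =
      (2 * Real.pi * Complex.I) ^ j •
        fourierMultiplierCLM V (fun ξ => (∏ i, inner ℝ ξ (v i)) * σ ξ) g := by
  induction j with
  | zero => simp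
  | succ j ih =>
    have htail : (fun ξ : E => (∏ i, inner ℝ ξ (Fin.tail v i)) * σ ξ).HasTemperateGrowth :=
      (hasTemperateGrowth_prod_inner _).mul hσ
    rw [iteratedLineDerivOp_succ_left, ih, lineDerivOp_smul, lineDeriv_eq_fourierMultiplierCLM,
      fourierMultiplierCLM_fourierMultiplierCLM_apply (by fun_prop) htail, smul_smul, ← pow_succ]
    congr 3
    ext ξ
    simp only [Pi.mul_apply, Fin.prod_univ_succ, Fin.tail]
    ring

theorem norm_iteratedFDeriv_fourierMultiplierCLM_apply (g : 𝓢(E, V)) {j : ℕ} (v : Fin j → E)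
    (x : E) :
    ‖iteratedFDeriv ℝ j (fourierMultiplierCLM V σ g) x v‖ =
      (2 * Real.pi) ^ j *
        ‖fourierMultiplierCLM V (fun ξ => (∏ i, inner ℝ ξ (v i)) * σ ξ) g x‖ := by
  rw [← iteratedLineDerivOp_eq_iteratedFDeriv, iteratedLineDerivOp_fourierMultiplierCLM hσ,
    smul_apply, norm_smul, norm_pow]
  simp [abs_of_pos Real.pi_pos]

end FourierMultiplier

theorem norm_le_sum_norm_apply_orthonormalBasis {E V ι : Type*} [NormedAddCommGroup E]
    [InnerProductSpace ℝ E] [NormedAddCommGroup V] [NormedSpace ℝ V] [Fintype ι]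
    (b : OrthonormalBasis ι ℝ E) {j : ℕ} (f : ContinuousMultilinearMap ℝ (fun _ : Fin j => E) V) :
    ‖f‖ ≤ ∑ r : Fin j → ι, ‖f (fun i => b (r i))‖ := by
  classical
  refine f.opNorm_le_bound (Finset.sum_nonneg fun _ _ => norm_nonneg _) fun x => ?_
  have hx : x = fun i => ∑ k, inner ℝ (b k) (x i) • b k := by
    ext1 i
    exact (b.sum_repr' (x i)).symm
  have hf : f x = ∑ r : Fin j → ι, (∏ i, inner ℝ (b (r i)) (x i)) • f (fun i => b (r i)) := by
    conv_lhs => rw [hx]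
    rw [f.map_sum]
    exact Finset.sum_congr rfl fun r _ => f.map_smul_univ _ _
  have hprod : ∀ r : Fin j → ι, ‖∏ i, inner ℝ (b (r i)) (x i)‖ ≤ ∏ i, ‖x i‖ := fun r => by
    rw [norm_prod]
    refine Finset.prod_le_prod (fun _ _ => norm_nonneg _) fun i _ => ?_
    simpa using norm_inner_le_norm (𝕜 := ℝ) (b (r i)) (x i)
  rw [hf, Finset.sum_mul]
  refine (norm_sum_le _ _).trans (Finset.sum_le_sum fun r _ => ?_)
  rw [norm_smul, mul_comm]
  exact mul_le_mul_of_nonneg_left (hprod r) (norm_nonneg _)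

theorem eLpNorm_iteratedFDeriv_le_sum {E W ι : Type*} [NormedAddCommGroup E]
    [InnerProductSpace ℝ E] [MeasurableSpace E] [OpensMeasurableSpace E] [NormedAddCommGroup W]
    [NormedSpace ℝ W] [Fintype ι] (b : OrthonormalBasis ι ℝ E) {j : ℕ} {h : E → W}
    (hh : ContDiff ℝ j h) {p : ℝ≥0∞} (hp : 1 ≤ p) (μ : Measure E) :
    eLpNorm (fun x => iteratedFDeriv ℝ j h x) p μ ≤
      ∑ r : Fin j → ι, eLpNorm (fun x => iteratedFDeriv ℝ j h x (fun i => b (r i))) p μ := by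
  have hcont : ∀ r : Fin j → ι, Continuous fun x => iteratedFDeriv ℝ j h x (fun i => b (r i)) :=
    fun r => (ContinuousMultilinearMap.apply ℝ (fun _ : Fin j => E) W
      (fun i => b (r i))).continuous.comp (hh.continuous_iteratedFDeriv le_rfl)
  calc eLpNorm (fun x => iteratedFDeriv ℝ j h x) p μ
      ≤ eLpNorm (∑ r : Fin j → ι, fun x => ‖iteratedFDeriv ℝ j h x (fun i => b (r i))‖) p μ :=
        eLpNorm_mono_real fun x => by
          simpa only [Finset.sum_apply] using norm_le_sum_norm_apply_orthonormalBasis b _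
    _ ≤ ∑ r : Fin j → ι, eLpNorm (fun x => ‖iteratedFDeriv ℝ j h x (fun i => b (r i))‖) p μ :=
        eLpNorm_sum_le (fun r _ => (hcont r).norm.aestronglyMeasurable) hp
    _ = _ := Finset.sum_congr rfl fun r _ => eLpNorm_norm _

theorem one_add_sum_pow_le {ι : Type*} [Fintype ι] (m : ℕ) {a : ι → ℝ} (ha : ∀ i, 0 ≤ a i) :
    (1 + ∑ i, a i) ^ m ≤ (Fintype.card ι + 1) ^ m * (1 + ∑ i, a i ^ m) := by
  cases m with
  | zero => simp
  | succ m =>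
    have hmean := pow_sum_div_card_le_sum_pow (s := (Finset.univ : Finset (Option ι)))
      (f := fun o => o.elim 1 a) (fun o _ => by cases o <;> simp [ha]) m
    simp only [Fintype.sum_option, Option.elim_none, Option.elim_some, one_pow, Finset.card_univ,
      Fintype.card_option, Nat.cast_add, Nat.cast_one] at hmean
    rw [div_le_iff₀' (by positivity)] at hmean
    have hsum : 0 ≤ 1 + ∑ i, a i ^ (m + 1) :=
      add_nonneg zero_le_one (Finset.sum_nonneg fun i _ => pow_nonneg (ha i) _)
    refine hmean.trans (mul_le_mul_of_nonneg_right ?_ hsum)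
    exact pow_le_pow_right₀ (by simp) m.le_succ

section BesselSymbol

variable {E : Type*} [NormedAddCommGroup E]

/-- The symbol `(1 + ‖ξ‖²)^(s/2)` of the Bessel potential of order `s`. -/
noncomputable def besselSymbol (s : ℝ) (ξ : E) : ℝ := (1 + ‖ξ‖ ^ 2) ^ (s / 2)

theorem besselSymbol_pos (s : ℝ) (ξ : E) : 0 < besselSymbol s ξ := by
  unfold besselSymbol; positivity

theorem besselSymbol_add (s t : ℝ) (ξ : E) :
    besselSymbol (s + t) ξ = besselSymbol s ξ * besselSymbol t ξ := by
  unfold besselSymbol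
  rw [← Real.rpow_add (by positivity)]
  ring_nf

theorem besselSymbol_zero (ξ : E) : besselSymbol 0 ξ = 1 := by simp [besselSymbol]

theorem besselSymbol_mono {s t : ℝ} (h : s ≤ t) (ξ : E) : besselSymbol s ξ ≤ besselSymbol t ξ := by
  unfold besselSymbol
  gcongr
  simp

theorem besselSymbol_natCast (j : ℕ) (ξ : E) :
    besselSymbol j ξ = √(1 + ‖ξ‖ ^ 2) ^ j := by
  rw [besselSymbol, Real.sqrt_eq_rpow, ← Real.rpow_mul_natCast (by positivity)]
  ring_nf

theorem norm_pow_le_besselSymbol (j : ℕ) (ξ : E) : ‖ξ‖ ^ j ≤ besselSymbol j ξ := by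
  rw [besselSymbol_natCast]
  gcongr
  exact Real.le_sqrt_of_sq_le (by linarith)

theorem besselSymbol_natCast_le (j : ℕ) (ξ : E) : besselSymbol j ξ ≤ (1 + ‖ξ‖) ^ j := by
  rw [besselSymbol_natCast]
  gcongr
  exact Real.sqrt_le_iff.2 ⟨by positivity, by nlinarith [norm_nonneg ξ]⟩

variable [InnerProductSpace ℝ E]

theorem besselSymbol_hasTemperateGrowth (s : ℝ) :
    (besselSymbol s : E → ℝ).HasTemperateGrowth := by
  unfold besselSymbol; fun_prop

theorem besselSymbol_ofReal_hasTemperateGrowth (s : ℝ) :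
    (fun ξ : E => (besselSymbol s ξ : ℂ)).HasTemperateGrowth := by
  unfold besselSymbol; fun_prop

theorem abs_prod_inner_mul_besselSymbol_le {j : ℕ} (v : Fin j → E) {s t : ℝ} (hs : j + s ≤ t)
    (ξ : E) : |(∏ i, inner ℝ ξ (v i)) * besselSymbol s ξ| ≤ (∏ i, ‖v i‖) * besselSymbol t ξ := by
  have hprod : |∏ i, inner ℝ ξ (v i)| ≤ (∏ i, ‖v i‖) * ‖ξ‖ ^ j := by
    rw [Finset.abs_prod]
    refine (Finset.prod_le_prod (fun _ _ => abs_nonneg _)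
      fun i _ => abs_real_inner_le_norm ξ (v i)).trans_eq ?_
    rw [Finset.prod_mul_distrib, Finset.prod_const, Finset.card_univ, Fintype.card_fin, mul_comm]
  have hs0 := (besselSymbol_pos s ξ).le
  calc |(∏ i, inner ℝ ξ (v i)) * besselSymbol s ξ|
      = |∏ i, inner ℝ ξ (v i)| * besselSymbol s ξ := by rw [abs_mul, abs_of_nonneg hs0]
    _ ≤ ((∏ i, ‖v i‖) * besselSymbol j ξ) * besselSymbol s ξ := by
        gcongr
        exact hprod.trans (by gcongr; exact norm_pow_le_besselSymbol j ξ)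
    _ = (∏ i, ‖v i‖) * besselSymbol (j + s) ξ := by rw [mul_assoc, besselSymbol_add]
    _ ≤ (∏ i, ‖v i‖) * besselSymbol t ξ := by gcongr; exact besselSymbol_mono hs ξ

theorem besselSymbol_natCast_le_mul_one_add_sum {ι : Type*} [Fintype ι]
    (b : OrthonormalBasis ι ℝ E) (m : ℕ) (ξ : E) :
    besselSymbol m ξ ≤ (Fintype.card ι + 1) ^ m * (1 + ∑ i, |inner ℝ ξ (b i)| ^ m) := by
  have hnorm : ‖ξ‖ ≤ ∑ i, |inner ℝ ξ (b i)| := by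
    conv_lhs => rw [← b.sum_repr' ξ]
    refine (norm_sum_le _ _).trans (Finset.sum_le_sum fun i _ => ?_)
    rw [norm_smul, b.norm_eq_one, mul_one, Real.norm_eq_abs, real_inner_comm]
  calc besselSymbol m ξ ≤ (1 + ‖ξ‖) ^ m := besselSymbol_natCast_le m ξ
    _ ≤ (1 + ∑ i, |inner ℝ ξ (b i)|) ^ m := by gcongr
    _ ≤ (Fintype.card ι + 1) ^ m * (1 + ∑ i, |inner ℝ ξ (b i)| ^ m) :=
        one_add_sum_pow_le m fun _ => abs_nonneg _

variable [FiniteDimensional ℝ E] [MeasurableSpace E] [BorelSpace E]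

theorem besselSymbol_memLp_two {s : ℝ} (hs : Module.finrank ℝ E < 2 * s) :
    MemLp (besselSymbol (-s) : E → ℝ) 2 volume := by
  rw [memLp_two_iff_integrable_sq
    (besselSymbol_hasTemperateGrowth _).1.continuous.aestronglyMeasurable]
  refine (integrable_rpow_neg_one_add_norm_sq hs).congr (Eventually.of_forall fun ξ => ?_)
  simp only [besselSymbol]
  rw [← Real.rpow_mul_natCast (by positivity)]
  congr 1
  push_cast
  ring

end BesselSymbol

section SchwartzBessel

open SchwartzMap

variable {E V : Type*} [NormedAddCommGroup E] [InnerProductSpace ℝ E] [FiniteDimensional ℝ E]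
  [MeasurableSpace E] [BorelSpace E] [NormedAddCommGroup V] [InnerProductSpace ℂ V]

/-- The Bessel potential `(1 + |ξ|²)^(s/2)(D)` of order `s` acting on Schwartz functions. -/
noncomputable def schwartzBessel (s : ℝ) : 𝓢(E, V) →L[ℝ] 𝓢(E, V) :=
  fourierMultiplierCLM V (besselSymbol s)

variable [CompleteSpace V]

theorem fourier_schwartzBessel_apply (s : ℝ) (f : 𝓢(E, V)) (ξ : E) :
    (𝓕 (schwartzBessel s f) : 𝓢(E, V)) ξ = besselSymbol s ξ • (𝓕 f : 𝓢(E, V)) ξ :=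
  fourier_fourierMultiplierCLM_apply (besselSymbol_hasTemperateGrowth s) f ξ

theorem eLpNorm_iteratedFDeriv_schwartzBessel_apply_le {s : ℝ} {j : ℕ} (hj : j ≤ s)
    (v : Fin j → E) (g : 𝓢(E, V)) :
    eLpNorm (fun x => iteratedFDeriv ℝ j (schwartzBessel (-s) g) x v) 2 volume ≤
      ENNReal.ofReal ((2 * Real.pi) ^ j * ∏ i, ‖v i‖) * eLpNorm g 2 volume := by
  let σ : E → ℝ := fun ξ => (∏ i, inner ℝ ξ (v i)) * besselSymbol (-s) ξ
  have hσ : ∀ ξ, |σ ξ| ≤ ∏ i, ‖v i‖ := fun ξ => by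
    simpa only [besselSymbol_zero, mul_one] using
      abs_prod_inner_mul_besselSymbol_le v (t := 0) (by linarith : j + -s ≤ 0) ξ
  calc eLpNorm (fun x => iteratedFDeriv ℝ j (schwartzBessel (-s) g) x v) 2 volume
      ≤ ENNReal.ofReal ((2 * Real.pi) ^ j) * eLpNorm (fourierMultiplierCLM V σ g) 2 volume :=
        eLpNorm_le_mul_eLpNorm_of_ae_le_mul (Eventually.of_forall fun x =>
          (norm_iteratedFDeriv_fourierMultiplierCLM_apply
            (besselSymbol_hasTemperateGrowth _) g v x).le) 2
    _ ≤ ENNReal.ofReal ((2 * Real.pi) ^ j) *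
          (ENNReal.ofReal (∏ i, ‖v i‖) * eLpNorm g 2 volume) := by
        gcongr
        exact eLpNorm_fourierMultiplierCLM_two_le
          ((hasTemperateGrowth_prod_inner v).mul (besselSymbol_hasTemperateGrowth _)) hσ g
    _ = _ := by rw [← mul_assoc, ← ENNReal.ofReal_mul (by positivity)]

theorem norm_iteratedFDeriv_schwartzBessel_apply_le {s t : ℝ} {j : ℕ} (hj : j + t ≤ s)
    (ht : Module.finrank ℝ E < 2 * t) (v : Fin j → E) (g : 𝓢(E, V)) (x : E) :
    ‖iteratedFDeriv ℝ j (schwartzBessel (-s) g) x v‖ ≤ (2 * Real.pi) ^ j *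
      (eLpNorm (besselSymbol (-t) : E → ℝ) 2 volume).toReal * ‖g.toLp 2‖ * ∏ i, ‖v i‖ := by
  have hL2 := besselSymbol_memLp_two ht
  let σ : E → ℝ := fun ξ => (∏ i, inner ℝ ξ (v i)) * besselSymbol (-s) ξ
  have hσ : σ.HasTemperateGrowth :=
    (hasTemperateGrowth_prod_inner v).mul (besselSymbol_hasTemperateGrowth _)
  have hσle : eLpNorm σ 2 volume ≤
      ENNReal.ofReal (∏ i, ‖v i‖) * eLpNorm (besselSymbol (-t) : E → ℝ) 2 volume := by
    refine eLpNorm_le_mul_eLpNorm_of_ae_le_mul (Eventually.of_forall fun ξ => ?_) 2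
    rw [Real.norm_of_nonneg (besselSymbol_pos _ _).le]
    exact abs_prod_inner_mul_besselSymbol_le v (by linarith) ξ
  have hfin := ENNReal.mul_ne_top (ENNReal.ofReal_ne_top (r := ∏ i, ‖v i‖)) hL2.2.ne
  have hσtoReal := ENNReal.toReal_mono hfin hσle
  rw [ENNReal.toReal_mul, ENNReal.toReal_ofReal (by positivity)] at hσtoReal
  have hσ2 : MemLp σ 2 volume :=
    ⟨hσ.1.continuous.aestronglyMeasurable, hσle.trans_lt hfin.lt_top⟩
  calc ‖iteratedFDeriv ℝ j (schwartzBessel (-s) g) x v‖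
      = (2 * Real.pi) ^ j * ‖fourierMultiplierCLM V σ g x‖ :=
        norm_iteratedFDeriv_fourierMultiplierCLM_apply (besselSymbol_hasTemperateGrowth _) g v x
    _ ≤ (2 * Real.pi) ^ j * ((eLpNorm σ 2 volume).toReal * ‖g.toLp 2‖) := by
        gcongr
        exact norm_fourierMultiplierCLM_apply_le hσ hσ2 g x
    _ ≤ (2 * Real.pi) ^ j * (((∏ i, ‖v i‖) *
          (eLpNorm (besselSymbol (-t) : E → ℝ) 2 volume).toReal) * ‖g.toLp 2‖) := by gcongr
    _ = _ := by ring

theorem exists_norm_iteratedFDeriv_schwartzBessel_le {s : ℝ} {j : ℕ}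
    (hj : Module.finrank ℝ E + 2 * j < 2 * s) :
    ∃ C : ℝ, 0 ≤ C ∧ ∀ (g : 𝓢(E, V)) (x : E),
      ‖iteratedFDeriv ℝ j (schwartzBessel (-s) g) x‖ ≤ C * ‖g.toLp 2‖ :=
  ⟨(2 * Real.pi) ^ j * (eLpNorm (besselSymbol (-(s - j)) : E → ℝ) 2 volume).toReal,
    by positivity, fun g x => ContinuousMultilinearMap.opNorm_le_bound (by positivity) fun v =>
      norm_iteratedFDeriv_schwartzBessel_apply_le (by linarith) (by linarith) v g x⟩

theorem exists_eLpNorm_iteratedFDeriv_schwartzBessel_le {s : ℝ} {j : ℕ} (hj : j ≤ s) :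
    ∃ C : ℝ, 0 ≤ C ∧ ∀ g : 𝓢(E, V),
      eLpNorm (fun x => iteratedFDeriv ℝ j (schwartzBessel (-s) g) x) 2 volume ≤
        ENNReal.ofReal (C * ‖g.toLp 2‖) := by
  let b := stdOrthonormalBasis ℝ E
  refine ⟨∑ _r : Fin j → Fin (Module.finrank ℝ E), (2 * Real.pi) ^ j, by positivity, fun g => ?_⟩
  refine (eLpNorm_iteratedFDeriv_le_sum b ((smooth _ _).of_le (mod_cast le_top)) one_le_two
    volume).trans ?_
  rw [Finset.sum_mul, ENNReal.ofReal_sum_of_nonneg (fun _ _ => by positivity)]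
  refine Finset.sum_le_sum fun r _ => ?_
  rw [ENNReal.ofReal_mul (by positivity), ofReal_norm_schwartz_toLp]
  simpa only [b.norm_eq_one, Finset.prod_const_one, mul_one] using
    eLpNorm_iteratedFDeriv_schwartzBessel_apply_le hj (fun i => b (r i)) g

theorem eLpNorm_fourierMultiplierCLM_inner_pow_le {e : E} (he : ‖e‖ = 1) (m : ℕ) (f : 𝓢(E, V)) :
    eLpNorm (fourierMultiplierCLM V (fun ξ : E => inner ℝ ξ e ^ m) f) 2 volume ≤
      eLpNorm (fun x => iteratedFDeriv ℝ m f x) 2 volume := by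
  refine eLpNorm_mono fun x => ?_
  have hderiv : ‖iteratedFDeriv ℝ m f x fun _ => e‖ = (2 * Real.pi) ^ m *
      ‖fourierMultiplierCLM V (fun ξ : E => inner ℝ ξ e ^ m) f x‖ := by
    simpa using norm_iteratedFDeriv_fourierMultiplierCLM_apply
      (Function.HasTemperateGrowth.const (1 : ℝ)) f (fun _ : Fin m => e) x
  have hπ : 1 ≤ (2 * Real.pi) ^ m := one_le_pow₀ (by linarith [Real.pi_gt_three])
  calc _ ≤ (2 * Real.pi) ^ m * ‖fourierMultiplierCLM V (fun ξ : E => inner ℝ ξ e ^ m) f x‖ :=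
        le_mul_of_one_le_left (norm_nonneg _) hπ
    _ = ‖iteratedFDeriv ℝ m f x fun _ => e‖ := hderiv.symm
    _ ≤ ‖iteratedFDeriv ℝ m f x‖ := by
        simpa [he] using (iteratedFDeriv ℝ m f x).le_opNorm fun _ => e

theorem norm_fourier_schwartzBessel_natCast_apply_le {ι : Type*} [Fintype ι]
    (b : OrthonormalBasis ι ℝ E) (m : ℕ) (f : 𝓢(E, V)) (ξ : E) :
    ‖(𝓕 (schwartzBessel m f) : 𝓢(E, V)) ξ‖ ≤ (Fintype.card ι + 1) ^ m * (‖(𝓕 f : 𝓢(E, V)) ξ‖ +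
      ∑ i, ‖(𝓕 (fourierMultiplierCLM V (fun ξ : E => inner ℝ ξ (b i) ^ m) f) : 𝓢(E, V)) ξ‖) := by
  have hpow : ∀ i, ‖(𝓕 (fourierMultiplierCLM V (fun ξ : E => inner ℝ ξ (b i) ^ m) f) :
      𝓢(E, V)) ξ‖ = |inner ℝ ξ (b i)| ^ m * ‖(𝓕 f : 𝓢(E, V)) ξ‖ := fun i => by
    rw [fourier_fourierMultiplierCLM_apply (by fun_prop), norm_smul, norm_pow, Real.norm_eq_abs]
  simp only [hpow, ← Finset.sum_mul]
  rw [fourier_schwartzBessel_apply, norm_smul, Real.norm_of_nonneg (besselSymbol_pos _ _).le]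
  refine (mul_le_mul_of_nonneg_right (besselSymbol_natCast_le_mul_one_add_sum b m ξ)
    (norm_nonneg _)).trans_eq ?_
  ring

theorem eLpNorm_schwartzBessel_natCast_le {ι : Type*} [Fintype ι] (b : OrthonormalBasis ι ℝ E)
    (m : ℕ) (f : 𝓢(E, V)) :
    eLpNorm (schwartzBessel m f) 2 volume ≤ ENNReal.ofReal ((Fintype.card ι + 1) ^ m) *
      (eLpNorm f 2 volume +
        Fintype.card ι * eLpNorm (fun x => iteratedFDeriv ℝ m f x) 2 volume) := by
  let D : ι → 𝓢(E, V) := fun i => fourierMultiplierCLM V (fun ξ : E => inner ℝ ξ (b i) ^ m) f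
  have hmeas : ∀ u : 𝓢(E, V), AEStronglyMeasurable (fun ξ => ‖u ξ‖) volume :=
    fun u => u.continuous.norm.aestronglyMeasurable
  calc eLpNorm (schwartzBessel m f) 2 volume
      = eLpNorm (𝓕 (schwartzBessel m f) : 𝓢(E, V)) 2 volume :=
        (eLpNorm_fourier_schwartz_two _).symm
    _ ≤ ENNReal.ofReal ((Fintype.card ι + 1) ^ m) * eLpNorm ((fun ξ => ‖(𝓕 f : 𝓢(E, V)) ξ‖) +
          ∑ i, fun ξ => ‖(𝓕 (D i) : 𝓢(E, V)) ξ‖) 2 volume := by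
        refine eLpNorm_le_mul_eLpNorm_of_ae_le_mul (Eventually.of_forall fun ξ => ?_) 2
        refine (norm_fourier_schwartzBessel_natCast_apply_le b m f ξ).trans ?_
        rw [Pi.add_apply, Finset.sum_apply]
        gcongr
        exact Real.le_norm_self _
    _ ≤ ENNReal.ofReal ((Fintype.card ι + 1) ^ m) *
          (eLpNorm f 2 volume + ∑ i, eLpNorm (D i) 2 volume) := by
        gcongr
        refine (eLpNorm_add_le (hmeas _) (Finset.aestronglyMeasurable_sum _ fun i _ => hmeas _)
          one_le_two).trans (add_le_add ?_ ?_)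
        · rw [eLpNorm_norm, eLpNorm_fourier_schwartz_two]
        · refine (eLpNorm_sum_le (fun i _ => hmeas _) one_le_two).trans_eq ?_
          simp only [eLpNorm_norm, eLpNorm_fourier_schwartz_two]
    _ ≤ _ := by
        gcongr
        refine (Finset.sum_le_sum fun i _ =>
          eLpNorm_fourierMultiplierCLM_inner_pow_le (b.norm_eq_one i) m f).trans_eq ?_
        rw [Finset.sum_const, Finset.card_univ, nsmul_eq_mul]

theorem exists_eLpNorm_schwartzBessel_natCast_le (m : ℕ) :
    ∃ C : ℝ, 0 ≤ C ∧ ∀ f : 𝓢(E, V), eLpNorm (schwartzBessel m f) 2 volume ≤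
      ENNReal.ofReal C *
        (eLpNorm f 2 volume + eLpNorm (fun x => iteratedFDeriv ℝ m f x) 2 volume) := by
  let d := Module.finrank ℝ E
  refine ⟨(d + 1) ^ m * (d + 1), by positivity, fun f => ?_⟩
  have hd : ENNReal.ofReal ((d : ℝ) + 1) = (d : ℝ≥0∞) + 1 := by
    rw [ENNReal.ofReal_add d.cast_nonneg zero_le_one, ENNReal.ofReal_natCast, ENNReal.ofReal_one]
  refine (eLpNorm_schwartzBessel_natCast_le (stdOrthonormalBasis ℝ E) m f).trans ?_
  rw [Fintype.card_fin, ENNReal.ofReal_mul (by positivity), mul_assoc, hd]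
  refine mul_le_mul_right ?_ _
  rw [mul_add]
  exact add_le_add (le_mul_of_one_le_left zero_le le_add_self) (mul_le_mul_left le_self_add _)

end SchwartzBessel

section GagliardoNirenberg

open SchwartzMap

theorem eLpNorm_two_le_of_integral_sq_le {α : Type*} [MeasurableSpace α] {μ : Measure α}
    {a b : α → ℝ} (ha : MemLp a 2 μ) (hb : MemLp b 2 μ) {c : ℝ} (hc : 0 ≤ c)
    (h : ∫ x, a x ^ 2 ∂μ ≤ c ^ 2 * ∫ x, b x ^ 2 ∂μ) :
    eLpNorm a 2 μ ≤ ENNReal.ofReal c * eLpNorm b 2 μ := by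
  rw [ha.eLpNorm_eq_integral_rpow_norm two_ne_zero ENNReal.ofNat_ne_top,
    hb.eLpNorm_eq_integral_rpow_norm two_ne_zero ENNReal.ofNat_ne_top, ← ENNReal.ofReal_mul hc]
  refine ENNReal.ofReal_le_ofReal ?_
  simp only [ENNReal.toReal_ofNat, Real.rpow_ofNat, Real.norm_eq_abs, sq_abs]
  rw [← one_div, ← Real.sqrt_eq_rpow, ← Real.sqrt_eq_rpow]
  refine (Real.sqrt_le_sqrt h).trans_eq ?_
  rw [Real.sqrt_mul (sq_nonneg c), Real.sqrt_sq hc]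

variable {E : Type*} [NormedAddCommGroup E] [InnerProductSpace ℝ E]

theorem lineDerivOp_smulLeftCLM_sq_self_apply (q : 𝓢(E, ℝ)) (e x : E) :
    (∂_{e} (smulLeftCLM ℝ (fun x => q x ^ 2) q)) x = 3 * q x ^ 2 * (∂_{e} q) x := by
  have hcube : ⇑(smulLeftCLM ℝ (fun x => q x ^ 2) q) = fun x => q x ^ 3 := by
    ext x
    rw [smulLeftCLM_apply_apply (q.hasTemperateGrowth.fun_pow 2), smul_eq_mul, ← pow_succ]
  rw [lineDerivOp_apply_eq_fderiv, hcube, (q.differentiableAt.hasFDerivAt.pow 3).fderiv]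
  simp [lineDerivOp_apply_eq_fderiv]

theorem norm_lineDerivOp_lineDerivOp_apply_le (w : 𝓢(E, ℝ)) {e : E} (he : ‖e‖ = 1) (x : E) :
    ‖(∂_{e} (∂_{e} w)) x‖ ≤ ‖iteratedFDeriv ℝ 2 w x‖ := by
  change ‖(∂^{fun _ : Fin 2 => e} w) x‖ ≤ _
  rw [iteratedLineDerivOp_eq_iteratedFDeriv]
  refine ((iteratedFDeriv ℝ 2 w x).le_opNorm fun _ => e).trans_eq ?_
  simp [he]

variable [FiniteDimensional ℝ E] [MeasurableSpace E] [BorelSpace E]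

theorem integrable_mul_schwartz {f : E → ℝ} (hf : f.HasTemperateGrowth) (g : 𝓢(E, ℝ)) :
    Integrable (fun x => f x * g x) := by
  refine (smulLeftCLM ℝ f g).integrable.congr (Eventually.of_forall fun x => ?_)
  rw [smulLeftCLM_apply_apply hf, smul_eq_mul]

theorem integral_lineDerivOp_pow_four (w : 𝓢(E, ℝ)) (e : E) :
    ∫ x, (∂_{e} w) x ^ 4 = -∫ x, 3 * (∂_{e} w) x ^ 2 * (∂_{e} (∂_{e} w)) x * w x := by
  set q := ∂_{e} w with hq
  have hparts := integral_mul_lineDerivOp_right_eq_neg_left (μ := volume)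
    (smulLeftCLM ℝ (fun x => q x ^ 2) q) w e
  simp only [lineDerivOp_smulLeftCLM_sq_self_apply,
    smulLeftCLM_apply_apply (q.hasTemperateGrowth.fun_pow 2), smul_eq_mul, ← hq] at hparts
  rw [← hparts]
  exact integral_congr_ae (Eventually.of_forall fun x => by ring)

theorem integral_lineDerivOp_pow_four_le (w : 𝓢(E, ℝ)) (e : E) {S : ℝ} (hS : ∀ x, |w x| ≤ S) :
    ∫ x, (∂_{e} w) x ^ 4 ≤ (3 * S) ^ 2 * ∫ x, (∂_{e} (∂_{e} w)) x ^ 2 := by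
  rw [integral_lineDerivOp_pow_four]
  set q := ∂_{e} w
  set s := ∂_{e} q
  have hq : (q : E → ℝ).HasTemperateGrowth := q.hasTemperateGrowth
  have hs : (s : E → ℝ).HasTemperateGrowth := s.hasTemperateGrowth
  have hq4 : Integrable fun x => (1 / 2) * q x ^ 4 :=
    ((integrable_mul_schwartz (hq.fun_pow 3) q).const_mul (1 / 2)).congr
      (Eventually.of_forall fun x => by ring)
  have hs2 : Integrable fun x => 9 / 2 * S ^ 2 * s x ^ 2 :=
    ((integrable_mul_schwartz hs s).const_mul (9 / 2 * S ^ 2)).congr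
      (Eventually.of_forall fun x => by ring)
  have hqsw : Integrable fun x => 3 * q x ^ 2 * s x * w x :=
    (integrable_mul_schwartz (by fun_prop) w)
  -- AM-GM: `3 q² |s w| ≤ q⁴ / 2 + 9 (s w)² / 2`, and the `q⁴` term is absorbed.
  have hyoung : -∫ x, 3 * q x ^ 2 * s x * w x ≤
      ∫ x, ((1 / 2) * q x ^ 4 + 9 / 2 * S ^ 2 * s x ^ 2) := by
    rw [← integral_neg]
    refine integral_mono hqsw.neg (hq4.add hs2) fun x => ?_
    have hw : (s x * w x) ^ 2 ≤ S ^ 2 * s x ^ 2 := by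
      rw [mul_pow, mul_comm]
      exact mul_le_mul_of_nonneg_right
        (sq_le_sq' (neg_le_of_abs_le (hS x)) (le_of_abs_le (hS x))) (sq_nonneg _)
    simp only
    nlinarith [sq_nonneg (q x ^ 2 + 3 * (s x * w x))]
  rw [integral_add hq4 hs2, integral_const_mul, integral_const_mul,
    integral_lineDerivOp_pow_four] at hyoung
  linarith

theorem eLpNorm_fderiv_apply_sq_le (w : 𝓢(E, ℝ)) {e : E} (he : ‖e‖ = 1) {S : ℝ}
    (hS : ∀ x, |w x| ≤ S) :
    eLpNorm (fun x => fderiv ℝ w x e ^ 2) 2 volume ≤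
      ENNReal.ofReal (3 * S) * eLpNorm (fun x => iteratedFDeriv ℝ 2 w x) 2 volume := by
  have hS0 : 0 ≤ S := (abs_nonneg _).trans (hS 0)
  set q : 𝓢(E, ℝ) := ∂_{e} w
  have hq2 : MemLp (fun x => q x ^ 2) 2 volume := by
    refine ((smulLeftCLM ℝ q q).memLp 2).ae_eq (Eventually.of_forall fun x => ?_)
    simp only [smulLeftCLM_apply_apply q.hasTemperateGrowth, smul_eq_mul, sq]
  have hint : ∫ x, (q x ^ 2) ^ 2 ≤ (3 * S) ^ 2 * ∫ x, (∂_{e} q) x ^ 2 := by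
    simp only [← pow_mul]
    exact integral_lineDerivOp_pow_four_le w e hS
  refine (eLpNorm_two_le_of_integral_sq_le hq2 ((∂_{e} q).memLp 2) (by positivity) hint).trans ?_
  gcongr
  exact eLpNorm_mono (norm_lineDerivOp_lineDerivOp_apply_le w he)

end GagliardoNirenberg

section HomogeneousNonlinearity

variable {Y W : Type*} [NormedAddCommGroup Y] [NormedSpace ℝ Y]
  [NormedAddCommGroup W] [NormedSpace ℝ W] {m : ℕ} {C : ℝ} {F G H : Y → W}

theorem exists_nonneg_forall_of_monotone {P : ℕ → ℝ → Prop} (hP : ∀ j, Monotone (P j))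
    (h : ∀ j ≤ m, ∃ C, P j C) : ∃ C, 0 ≤ C ∧ ∀ j ≤ m, P j C := by
  have hev : ∀ᶠ C in atTop, ∀ j ∈ Set.Iic m, P j C :=
    (eventually_all_finite (Set.finite_Iic m)).2 fun j hj =>
      (h j hj).elim fun C hC => (eventually_ge_atTop C).mono fun _ hle => hP j hle hC
  exact ((eventually_ge_atTop 0).and hev).exists

/-- `G` is smooth and its derivatives of order at most `m` are bounded, with constant `C`, like
those of a function that is positively homogeneous of degree `m` and smooth away from the origin.
Such functions replace a homogeneous nonlinearity, which need not be smooth at the origin. -/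
structure HomogeneousGrowth (m : ℕ) (C : ℝ) (G : Y → W) : Prop where
  nonneg : 0 ≤ C
  contDiff : ContDiff ℝ ∞ G
  norm_iteratedFDeriv_le : ∀ j ≤ m, ∀ y, ‖iteratedFDeriv ℝ j G y‖ ≤ C * ‖y‖ ^ (m - j)

namespace HomogeneousGrowth

theorem norm_le (hG : HomogeneousGrowth m C G) (y : Y) : ‖G y‖ ≤ C * ‖y‖ ^ m := by
  simpa using hG.norm_iteratedFDeriv_le 0 (Nat.zero_le m) y

theorem norm_sub_le (hG : HomogeneousGrowth m C G) (hm : 1 ≤ m) (a b : Y) :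
    ‖G a - G b‖ ≤ C * max ‖a‖ ‖b‖ ^ (m - 1) * ‖a - b‖ := by
  have hC := hG.nonneg
  refine (convex_closedBall (0 : Y) (max ‖a‖ ‖b‖)).norm_image_sub_le_of_norm_fderiv_le
    (𝕜 := ℝ) (fun x _ => (hG.contDiff.differentiable (by simp)).differentiableAt)
    (fun x hx => ?_) (by simp) (by simp)
  rw [← norm_iteratedFDeriv_one]
  refine (hG.norm_iteratedFDeriv_le 1 hm x).trans ?_
  gcongr
  simpa using hx

theorem rescale (hG : HomogeneousGrowth m C G) {t : ℝ} (ht : 0 < t) :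
    HomogeneousGrowth m C fun y => (t ^ m)⁻¹ • G (t • y) where
  nonneg := hG.nonneg
  contDiff := contDiff_const.smul (hG.contDiff.comp (contDiff_const_smul t))
  norm_iteratedFDeriv_le j hj y := by
    have hGj : ContDiff ℝ j G := hG.contDiff.of_le (mod_cast le_top)
    have hcomp : ContDiff ℝ j fun y => G (t • y) := hGj.comp (contDiff_const_smul t)
    rw [iteratedFDeriv_const_smul_apply' hcomp.contDiffAt, iteratedFDeriv_comp_const_smul t hGj,
      norm_smul, norm_smul, norm_inv, norm_pow, norm_pow, Real.norm_of_nonneg ht.le,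
      inv_mul_le_iff₀ (by positivity)]
    refine (mul_le_mul_of_nonneg_left (hG.norm_iteratedFDeriv_le j hj (t • y))
      (by positivity)).trans_eq ?_
    rw [norm_smul, Real.norm_of_nonneg ht.le, mul_pow, ← pow_mul_pow_sub t hj]
    ring

end HomogeneousGrowth

theorem norm_iteratedFDeriv_smul_of_eventuallyEq {j : ℕ} (hH : ContDiff ℝ j H) (hj : j ≤ m)
    {t : ℝ} (ht : 0 < t) {y : Y} (h : ∀ᶠ z in 𝓝 y, H (t • z) = t ^ m • H z) :
    ‖iteratedFDeriv ℝ j H (t • y)‖ = t ^ (m - j) * ‖iteratedFDeriv ℝ j H y‖ := by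
  have hD : iteratedFDeriv ℝ j (fun z => H (t • z)) y = iteratedFDeriv ℝ j (t ^ m • H) y :=
    (EventuallyEq.iteratedFDeriv ℝ (f₁ := fun z => H (t • z)) h j).self_of_nhds
  rw [iteratedFDeriv_comp_const_smul t hH, iteratedFDeriv_const_smul_apply hH.contDiffAt] at hD
  replace hD := congrArg norm hD
  simp only [norm_smul, norm_pow, Real.norm_of_nonneg ht.le] at hD
  rw [← pow_mul_pow_sub t hj, mul_assoc] at hD
  exact mul_left_cancel₀ (pow_pos ht j).ne' hD

variable [FiniteDimensional ℝ Y]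

theorem exists_norm_le_mul_norm_pow_of_eventuallyEq_zero {Z : Type*} [NormedAddCommGroup Z]
    {Φ : Y → Z} (hΦ : Continuous Φ) (h0 : Φ =ᶠ[𝓝 0] 0) (k : ℕ) (R : ℝ) :
    ∃ C, ∀ y, ‖y‖ ≤ R → ‖Φ y‖ ≤ C * ‖y‖ ^ k := by
  obtain ⟨r, hr, hball⟩ := Metric.eventually_nhds_iff.1 h0
  obtain ⟨B, hB⟩ :=
    (isCompact_closedBall (0 : Y) (max R 0)).exists_bound_of_continuousOn hΦ.continuousOn
  have hB0 : 0 ≤ B := (norm_nonneg _).trans (hB 0 (by simp))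
  refine ⟨B / r ^ k, fun y hy => ?_⟩
  rcases lt_or_ge ‖y‖ r with hyr | hyr
  · rw [hball (by rwa [dist_zero_right]), Pi.zero_apply, norm_zero]
    positivity
  · rw [div_mul_eq_mul_div, le_div_iff₀ (by positivity)]
    have hBy := hB y (by simp [hy])
    gcongr

theorem exists_norm_iteratedFDeriv_le_mul_norm_pow {j : ℕ} (hH : ContDiff ℝ j H) (hj : j ≤ m)
    (h0 : H =ᶠ[𝓝 0] 0) (h1 : ∀ t : ℝ, 1 ≤ t → ∀ y, 1 ≤ ‖y‖ → H (t • y) = t ^ m • H y) :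
    ∃ C, ∀ y, ‖iteratedFDeriv ℝ j H y‖ ≤ C * ‖y‖ ^ (m - j) := by
  have hD0 : iteratedFDeriv ℝ j H =ᶠ[𝓝 0] 0 := by
    simpa only [iteratedFDeriv_zero] using h0.iteratedFDeriv ℝ j
  obtain ⟨C, hC⟩ := exists_norm_le_mul_norm_pow_of_eventuallyEq_zero
    (hH.continuous_iteratedFDeriv le_rfl) hD0 (m - j) 2
  refine ⟨C, fun y => ?_⟩
  rcases le_or_gt ‖y‖ 2 with hy | hy
  · exact hC y hy
  obtain ⟨t, z, ht, hz, rfl⟩ : ∃ (t : ℝ) (z : Y), 1 ≤ t ∧ ‖z‖ = 2 ∧ t • z = y := by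
    refine ⟨‖y‖ / 2, (‖y‖ / 2)⁻¹ • y, by linarith, ?_, smul_inv_smul₀ (by positivity) y⟩
    rw [norm_smul, norm_inv, Real.norm_of_nonneg (by positivity)]
    field_simp
  have hhom : ∀ᶠ w in 𝓝 z, H (t • w) = t ^ m • H w :=
    (continuous_norm.continuousAt.eventually_const_lt (by simp [hz])).mono
      fun w hw => h1 t ht w hw.le
  rw [norm_iteratedFDeriv_smul_of_eventuallyEq hH hj (by linarith) hhom, norm_smul, mul_pow,
    Real.norm_of_nonneg (by linarith)]
  refine (mul_le_mul_of_nonneg_left (hC z hz.le) (by positivity)).trans_eq ?_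
  ring

theorem exists_homogeneousGrowth (hH : ContDiff ℝ ∞ H) (h0 : H =ᶠ[𝓝 0] 0)
    (h1 : ∀ t : ℝ, 1 ≤ t → ∀ y, 1 ≤ ‖y‖ → H (t • y) = t ^ m • H y) :
    ∃ C, HomogeneousGrowth m C H := by
  obtain ⟨C, hC0, hC⟩ := exists_nonneg_forall_of_monotone
    (P := fun j C => ∀ y, ‖iteratedFDeriv ℝ j H y‖ ≤ C * ‖y‖ ^ (m - j))
    (fun j C C' hCC' hC y => (hC y).trans (by gcongr))
    (fun j hj => exists_norm_iteratedFDeriv_le_mul_norm_pow (hH.of_le (mod_cast le_top)) hj h0 h1)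
  exact ⟨C, hC0, hH, hC⟩

theorem exists_contDiff_eventuallyEq_zero_and_eq_of_one_le_norm (hF : ContDiffOn ℝ ∞ F {0}ᶜ) :
    ∃ H : Y → W, ContDiff ℝ ∞ H ∧ H =ᶠ[𝓝 0] 0 ∧ ∀ y, 1 ≤ ‖y‖ → H y = F y := by
  let χ : ContDiffBump (0 : Y) := ⟨1 / 2, 1, by norm_num, by norm_num⟩
  have h0 : (fun y => (1 - χ y) • F y) =ᶠ[𝓝 0] 0 := by
    filter_upwards [χ.eventuallyEq_one] with y hy
    simp [hy]
  refine ⟨fun y => (1 - χ y) • F y, contDiff_iff_contDiffAt.2 fun y => ?_, h0, fun y hy => ?_⟩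
  · rcases eq_or_ne y 0 with rfl | hy
    · exact contDiffAt_const.congr_of_eventuallyEq h0
    · exact (contDiffAt_const.sub χ.contDiff.contDiffAt).smul
        (hF.contDiffAt (isOpen_compl_singleton.mem_nhds hy))
  · have hχ : χ y = 0 := χ.zero_of_le_dist (by simpa using hy)
    simp [hχ]

theorem exists_homogeneousGrowth_tendsto (hF : ContDiffOn ℝ ∞ F {0}ᶜ) (hm : m ≠ 0)
    (hhom : ∀ t : ℝ, 0 ≤ t → ∀ y, F (t • y) = t ^ m • F y) :
    ∃ (C : ℝ) (G : ℕ → Y → W), (∀ k, HomogeneousGrowth m C (G k)) ∧ (∀ k, G k =ᶠ[𝓝 0] 0) ∧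
      ∀ y, Tendsto (fun k => G k y) atTop (𝓝 (F y)) := by
  obtain ⟨H, hH, h0, hHF⟩ := exists_contDiff_eventuallyEq_zero_and_eq_of_one_le_norm hF
  obtain ⟨C, hC⟩ := exists_homogeneousGrowth (m := m) hH h0 fun t ht y hy => by
    have hty : 1 ≤ ‖t • y‖ := by
      rw [norm_smul, Real.norm_of_nonneg (by linarith)]
      exact one_le_mul_of_one_le_of_one_le ht hy
    rw [hHF _ hty, hHF y hy, hhom t (by linarith)]
  have hpos : ∀ k : ℕ, (0 : ℝ) < k + 1 := fun k => by positivity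
  refine ⟨C, fun k y => (((k : ℝ) + 1) ^ m)⁻¹ • H (((k : ℝ) + 1) • y),
    fun k => hC.rescale (hpos k), fun k => ?_, fun y => ?_⟩
  · have hlim : Tendsto (fun y : Y => ((k : ℝ) + 1) • y) (𝓝 0) (𝓝 0) := by
      simpa using (continuous_const_smul ((k : ℝ) + 1)).tendsto (0 : Y)
    filter_upwards [hlim.eventually h0] with y hy
    simp [hy]
  rcases eq_or_ne y 0 with rfl | hy
  · have hF0 : F 0 = 0 := by simpa [hm] using hhom 0 le_rfl 0
    simp [hF0, h0.self_of_nhds]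
  · have hlarge : ∀ᶠ k : ℕ in atTop, 1 ≤ ((k : ℝ) + 1) * ‖y‖ :=
      ((tendsto_atTop_add_const_right _ 1 tendsto_natCast_atTop_atTop).atTop_mul_const
        (norm_pos_iff.2 hy)).eventually_ge_atTop 1
    refine tendsto_const_nhds.congr' (hlarge.mono fun k hk => ?_)
    simp only
    rw [hHF, hhom _ (hpos k).le, inv_smul_smul₀ (pow_pos (hpos k) m).ne']
    rwa [norm_smul, Real.norm_of_nonneg (hpos k).le]

end HomogeneousNonlinearity

section Composition

theorem sum_partSize_orderedFinpartition {m : ℕ} (c : OrderedFinpartition m) :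
    ∑ i, c.partSize i = m := by
  simpa using c.sum_sigma_eq_sum (fun _ : Fin m => (1 : ℕ))

theorem partSize_add_partSize_le {m : ℕ} (c : OrderedFinpartition m) {i j : Fin c.length}
    (hij : i ≠ j) : c.partSize i + c.partSize j ≤ m := by
  conv_rhs => rw [← sum_partSize_orderedFinpartition c]
  rw [← Finset.sum_pair hij]
  exact Finset.sum_le_sum_of_subset (Finset.subset_univ _)

/- At most one part exceeds `m - 2`, except for the partition of a pair into singletons: this is
why a product of first derivatives needs a separate `L⁴` bound when `m = 2`, and only then. -/
theorem exists_forall_partSize_add_two_le_or_eq_two {m : ℕ} (hm : 1 ≤ m)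
    (c : OrderedFinpartition m) :
    (∃ i₀, ∀ i ≠ i₀, c.partSize i + 2 ≤ m) ∨ m = 2 ∧ c.length = 2 ∧ ∀ i, c.partSize i = 1 := by
  have : Nonempty (Fin c.length) := ⟨⟨0, c.length_pos hm⟩⟩
  obtain ⟨i₀, hmax⟩ := Finite.exists_max c.partSize
  by_cases h : ∀ i ≠ i₀, c.partSize i + 2 ≤ m
  · exact Or.inl ⟨i₀, h⟩
  push Not at h
  obtain ⟨i, hi, hlarge⟩ := h
  have hpair := partSize_add_partSize_le c hi
  have hmax_i := hmax i
  have hpos_i := c.partSize_pos i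
  have hone : ∀ k, c.partSize k = 1 := fun k => by
    have := hmax k
    have := c.partSize_pos k
    omega
  have hlength := sum_partSize_orderedFinpartition c
  simp only [hone, Finset.sum_const, Finset.card_univ, Fintype.card_fin, smul_eq_mul,
    mul_one] at hlength
  exact Or.inr ⟨by omega, by omega, hone⟩

variable {E Y W : Type*} [NormedAddCommGroup E] [NormedSpace ℝ E]
  [NormedAddCommGroup Y] [NormedSpace ℝ Y] [NormedAddCommGroup W] [NormedSpace ℝ W]
  {m : ℕ} {G : Y → W} {v : E → Y} {B C : ℝ}

theorem norm_iteratedFDeriv_comp_le_sum (hG : ContDiff ℝ m G) (hv : ContDiff ℝ m v) (x : E) :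
    ‖iteratedFDeriv ℝ m (G ∘ v) x‖ ≤ ∑ c : OrderedFinpartition m,
      ‖iteratedFDeriv ℝ c.length G (v x)‖ * ∏ i, ‖iteratedFDeriv ℝ (c.partSize i) v x‖ := by
  rw [iteratedFDeriv_comp hG.contDiffAt hv.contDiffAt le_rfl]
  exact (norm_sum_le _ _).trans
    (Finset.sum_le_sum fun c _ => c.norm_compAlongOrderedFinpartition_le _ _)

theorem HomogeneousGrowth.norm_iteratedFDeriv_comp_le (hG : HomogeneousGrowth m C G)
    (hv : ContDiff ℝ m v) (x : E) :
    ‖iteratedFDeriv ℝ m (G ∘ v) x‖ ≤ C * ∑ c : OrderedFinpartition m,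
      ‖v x‖ ^ (m - c.length) * ∏ i, ‖iteratedFDeriv ℝ (c.partSize i) v x‖ := by
  refine (norm_iteratedFDeriv_comp_le_sum (hG.contDiff.of_le (mod_cast le_top)) hv x).trans ?_
  rw [Finset.mul_sum]
  refine Finset.sum_le_sum fun c _ => ?_
  rw [← mul_assoc]
  exact mul_le_mul_of_nonneg_right (hG.norm_iteratedFDeriv_le _ c.length_le _) (by positivity)

variable [MeasureSpace E]

/-- The derivatives of `v` obey the bounds which membership in a ball of radius proportional to `B`
in the Sobolev space of order `m` provides, for `m = 1`, or for `m ≥ 2` in dimension at most `3`. -/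
structure SobolevDerivBound (m : ℕ) (v : E → Y) (B : ℝ) : Prop where
  nonneg : 0 ≤ B
  contDiff : ContDiff ℝ ∞ v
  eLpNorm_le : ∀ j ≤ m, eLpNorm (fun x => iteratedFDeriv ℝ j v x) 2 volume ≤ ENNReal.ofReal B
  norm_le : ∀ j, j + 2 ≤ m → ∀ x, ‖iteratedFDeriv ℝ j v x‖ ≤ B
  eLpNorm_sq_le : m = 2 →
    eLpNorm (fun x => ‖iteratedFDeriv ℝ 1 v x‖ ^ 2) 2 volume ≤ ENNReal.ofReal (B ^ 2)

namespace SobolevDerivBound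

theorem norm_pow_le (hv : SobolevDerivBound m v B) {k : ℕ} (hk : k + 1 ≤ m) (x : E) :
    ‖v x‖ ^ k ≤ B ^ k := by
  rcases Nat.eq_zero_or_pos k with rfl | hk0
  · simp
  · have := hv.norm_le 0 (by omega) x
    rw [norm_iteratedFDeriv_zero] at this
    gcongr

theorem norm_pow_mul_prod_le (hv : SobolevDerivBound m v B) {c : OrderedFinpartition m}
    {i₀ : Fin c.length} (hi₀ : ∀ i ≠ i₀, c.partSize i + 2 ≤ m) (x : E) :
    ‖v x‖ ^ (m - c.length) * ∏ i, ‖iteratedFDeriv ℝ (c.partSize i) v x‖ ≤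
      B ^ (m - 1) * ‖iteratedFDeriv ℝ (c.partSize i₀) v x‖ := by
  have hB := hv.nonneg
  have hlength : 0 < c.length ∧ c.length ≤ m := ⟨i₀.pos, c.length_le⟩
  have hprod : ∏ i ∈ Finset.univ.erase i₀, ‖iteratedFDeriv ℝ (c.partSize i) v x‖ ≤
      B ^ (c.length - 1) := by
    refine (Finset.prod_le_prod (fun _ _ => norm_nonneg _) (g := fun _ => B) fun i hi =>
      hv.norm_le _ (hi₀ i (Finset.ne_of_mem_erase hi)) x).trans_eq ?_
    simp [Finset.card_erase_of_mem]
  rw [← Finset.prod_erase_mul _ _ (Finset.mem_univ i₀), ← mul_assoc,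
    show m - 1 = m - c.length + (c.length - 1) by omega, pow_add]
  gcongr ?_ * _
  exact mul_le_mul (hv.norm_pow_le (by omega) x) hprod
    (Finset.prod_nonneg fun _ _ => norm_nonneg _) (by positivity)

theorem eLpNorm_norm_pow_mul_prod_le (hv : SobolevDerivBound m v B) (hm : 1 ≤ m)
    (c : OrderedFinpartition m) :
    eLpNorm (fun x => ‖v x‖ ^ (m - c.length) * ∏ i, ‖iteratedFDeriv ℝ (c.partSize i) v x‖)
      2 volume ≤ ENNReal.ofReal (B ^ m) := by
  have hB := hv.nonneg
  rcases exists_forall_partSize_add_two_le_or_eq_two hm c with ⟨i₀, hi₀⟩ | ⟨rfl, hlength, hone⟩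
  · refine (eLpNorm_le_mul_eLpNorm_of_ae_le_mul (g := iteratedFDeriv ℝ (c.partSize i₀) v)
      (c := B ^ (m - 1)) (Eventually.of_forall fun x => ?_) 2).trans
      ((mul_le_mul_right (hv.eLpNorm_le _ (c.partSize_le i₀)) _).trans_eq ?_)
    · exact (Real.norm_of_nonneg (by positivity)).trans_le (hv.norm_pow_mul_prod_le hi₀ x)
    · rw [← ENNReal.ofReal_mul (by positivity), ← pow_succ, Nat.sub_add_cancel hm]
  · have hpart : ∀ i x, ‖iteratedFDeriv ℝ (c.partSize i) v x‖ = ‖iteratedFDeriv ℝ 1 v x‖ :=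
      fun i x => by rw [hone]
    simp only [hpart, hlength, Finset.prod_const, Finset.card_univ, Fintype.card_fin,
      Nat.sub_self, pow_zero, one_mul]
    exact hv.eLpNorm_sq_le rfl

theorem eLpNorm_comp_le (hv : SobolevDerivBound m v B) (hm : 1 ≤ m)
    (hG : HomogeneousGrowth m C G) : eLpNorm (G ∘ v) 2 volume ≤ ENNReal.ofReal (C * B ^ m) := by
  have hB := hv.nonneg
  have hC := hG.nonneg
  have hpow : ∀ a : ℝ, a ^ m = a ^ (m - 1) * a := fun a => by rw [← pow_succ, Nat.sub_add_cancel hm]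
  have hbound : ∀ x, ‖(G ∘ v) x‖ ≤ C * B ^ (m - 1) * ‖iteratedFDeriv ℝ 0 v x‖ := fun x => by
    refine (hG.norm_le (v x)).trans ?_
    rw [hpow, ← mul_assoc, norm_iteratedFDeriv_zero]
    gcongr C * ?_ * _
    exact hv.norm_pow_le (by omega) x
  refine (eLpNorm_le_mul_eLpNorm_of_ae_le_mul (Eventually.of_forall hbound) 2).trans ?_
  refine (mul_le_mul_right (hv.eLpNorm_le 0 (Nat.zero_le _)) _).trans_eq ?_
  rw [← ENNReal.ofReal_mul (by positivity), mul_assoc, ← hpow]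

theorem eLpNorm_iteratedFDeriv_comp_le [OpensMeasurableSpace E] [SecondCountableTopologyEither E ℝ]
    (hv : SobolevDerivBound m v B) (hm : 1 ≤ m) (hG : HomogeneousGrowth m C G) :
    eLpNorm (fun x => iteratedFDeriv ℝ m (G ∘ v) x) 2 volume ≤
      ENNReal.ofReal (Fintype.card (OrderedFinpartition m) * C * B ^ m) := by
  let T : OrderedFinpartition m → E → ℝ := fun c x =>
    ‖v x‖ ^ (m - c.length) * ∏ i, ‖iteratedFDeriv ℝ (c.partSize i) v x‖
  have hT : ∀ c, AEStronglyMeasurable (T c) volume := fun c =>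
    ((hv.contDiff.continuous.norm.pow _).mul (continuous_finsetProd _ fun i _ =>
      (hv.contDiff.continuous_iteratedFDeriv (mod_cast le_top)).norm)).aestronglyMeasurable
  have hsum : eLpNorm (∑ c, T c) 2 volume ≤
      ∑ _c : OrderedFinpartition m, ENNReal.ofReal (B ^ m) :=
    (eLpNorm_sum_le (fun c _ => hT c) one_le_two).trans
      (Finset.sum_le_sum fun c _ => hv.eLpNorm_norm_pow_mul_prod_le hm c)
  refine (eLpNorm_le_mul_eLpNorm_of_ae_le_mul (g := ∑ c, T c) (c := C)
    (Eventually.of_forall fun x => ?_) 2).trans ((mul_le_mul_right hsum _).trans_eq ?_)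
  · refine (hG.norm_iteratedFDeriv_comp_le (hv.contDiff.of_le (mod_cast le_top)) x).trans
      (mul_le_mul_of_nonneg_left ?_ hG.nonneg)
    rw [Finset.sum_apply]
    exact Real.le_norm_self _
  · rw [Finset.sum_const, Finset.card_univ, nsmul_eq_mul, ← ENNReal.ofReal_natCast,
      ← ENNReal.ofReal_mul (by positivity), ← ENNReal.ofReal_mul hG.nonneg]
    congr 1
    ring

end SobolevDerivBound

end Composition

section APriori

theorem exists_norm_le_sum_abs_clm (Y : Type*) [NormedAddCommGroup Y] [NormedSpace ℝ Y]
    [FiniteDimensional ℝ Y] :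
    ∃ ℓ : Fin (Module.finrank ℝ Y) → Y →L[ℝ] ℝ, ∀ y, ‖y‖ ≤ ∑ a, |ℓ a y| := by
  let b := Module.finBasis ℝ Y
  refine ⟨fun a => ‖b a‖ • (b.coord a).toContinuousLinearMap, fun y => ?_⟩
  conv_lhs => rw [← b.sum_repr y]
  refine (norm_sum_le _ _).trans_eq (Finset.sum_congr rfl fun a _ => ?_)
  rw [norm_smul, mul_comm, smul_apply, smul_eq_mul, abs_mul, abs_norm,
    Real.norm_eq_abs]
  rfl

theorem norm_clm_le_sum_norm_apply_orthonormalBasis {E Y ι : Type*} [NormedAddCommGroup E]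
    [InnerProductSpace ℝ E] [NormedAddCommGroup Y] [NormedSpace ℝ Y] [Fintype ι]
    (b : OrthonormalBasis ι ℝ E) (T : E →L[ℝ] Y) : ‖T‖ ≤ ∑ i, ‖T (b i)‖ := by
  refine T.opNorm_le_bound (Finset.sum_nonneg fun _ _ => norm_nonneg _) fun x => ?_
  conv_lhs => rw [← b.sum_repr' x, map_sum]
  rw [Finset.sum_mul]
  refine (norm_sum_le _ _).trans (Finset.sum_le_sum fun i _ => ?_)
  rw [map_smul, norm_smul, mul_comm]
  gcongr
  simpa using norm_inner_le_norm (𝕜 := ℝ) (b i) x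

theorem norm_clm_sq_le_card_mul_sum_sq {E Y ι κ : Type*} [NormedAddCommGroup E]
    [InnerProductSpace ℝ E] [NormedAddCommGroup Y] [NormedSpace ℝ Y] [Fintype ι] [Fintype κ]
    (b : OrthonormalBasis ι ℝ E) {ℓ : κ → Y →L[ℝ] ℝ} (hℓ : ∀ y, ‖y‖ ≤ ∑ a, |ℓ a y|)
    (T : E →L[ℝ] Y) :
    ‖T‖ ^ 2 ≤ Fintype.card (ι × κ) * ∑ q : ι × κ, ℓ q.2 (T (b q.1)) ^ 2 := by
  have hsum : ‖T‖ ≤ ∑ q : ι × κ, |ℓ q.2 (T (b q.1))| := by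
    rw [Fintype.sum_prod_type]
    exact (norm_clm_le_sum_norm_apply_orthonormalBasis b T).trans
      (Finset.sum_le_sum fun i _ => hℓ _)
  calc ‖T‖ ^ 2 ≤ (∑ q : ι × κ, |ℓ q.2 (T (b q.1))|) ^ 2 := by gcongr
    _ ≤ _ := by
      refine sq_sum_le_card_mul_sum_sq.trans_eq ?_
      simp only [sq_abs, Finset.card_univ]

theorem hasCompactSupport_comp_of_tendsto_cocompact {X Y W : Type*} [TopologicalSpace X]
    [R1Space X] [TopologicalSpace Y] [Zero Y] [Zero W] {G : Y → W} {v : X → Y}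
    (hG : G =ᶠ[𝓝 0] 0) (hv : Tendsto v (cocompact X) (𝓝 0)) : HasCompactSupport (G ∘ v) := by
  obtain ⟨K, hK, hKv⟩ := mem_cocompact.1 (hv.eventually hG)
  exact HasCompactSupport.intro hK fun x hx => hKv hx

variable {E V Y W : Type*} [NormedAddCommGroup E] [InnerProductSpace ℝ E]
  [NormedAddCommGroup V] [InnerProductSpace ℂ V] [NormedAddCommGroup Y] [NormedSpace ℝ Y]
  [NormedAddCommGroup W] [InnerProductSpace ℂ W]

theorem norm_iteratedFDeriv_clm_comp_schwartz_le (L : V →L[ℝ] Y) (h : 𝓢(E, V)) (j : ℕ) (x : E) :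
    ‖iteratedFDeriv ℝ j (fun x => L (h x)) x‖ ≤ ‖L‖ * ‖iteratedFDeriv ℝ j h x‖ :=
  L.norm_iteratedFDeriv_comp_left (f := h) (h.smooth ⊤).contDiffAt (N := ∞) (mod_cast le_top)

variable [FiniteDimensional ℝ E] [MeasurableSpace E] [BorelSpace E]

theorem eLpNorm_iteratedFDeriv_clm_comp_schwartz_le (L : V →L[ℝ] Y) (h : 𝓢(E, V)) (j : ℕ) {T : ℝ}
    (hT : eLpNorm (fun x => iteratedFDeriv ℝ j h x) 2 volume ≤ ENNReal.ofReal T) :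
    eLpNorm (fun x => iteratedFDeriv ℝ j (fun y => L (h y)) x) 2 volume ≤
      ENNReal.ofReal (‖L‖ * T) := by
  rw [ENNReal.ofReal_mul (norm_nonneg _)]
  exact (eLpNorm_le_mul_eLpNorm_of_ae_le_mul (Eventually.of_forall fun x =>
    norm_iteratedFDeriv_clm_comp_schwartz_le L h j x) 2).trans (mul_le_mul_right hT _)

theorem eLpNorm_fderiv_clm_comp_schwartz_sq_le (ℓ : V →L[ℝ] ℝ) (h : 𝓢(E, V)) {S T : ℝ}
    (hS : ∀ x, ‖h x‖ ≤ S)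
    (hT : eLpNorm (fun x => iteratedFDeriv ℝ 2 h x) 2 volume ≤ ENNReal.ofReal T)
    {e : E} (he : ‖e‖ = 1) :
    eLpNorm (fun x => fderiv ℝ (fun y => ℓ (h y)) x e ^ 2) 2 volume ≤
      ENNReal.ofReal (3 * ‖ℓ‖ ^ 2 * (S * T)) := by
  have hS0 : 0 ≤ S := (norm_nonneg _).trans (hS 0)
  refine (eLpNorm_fderiv_apply_sq_le (h.postcompCLM ℓ) he (S := ‖ℓ‖ * S) fun x =>
    (ℓ.le_opNorm (h x)).trans (mul_le_mul_of_nonneg_left (hS x) (norm_nonneg _))).trans ?_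
  refine (mul_le_mul_right
    (eLpNorm_iteratedFDeriv_clm_comp_schwartz_le ℓ h 2 hT) _).trans_eq ?_
  rw [← ENNReal.ofReal_mul (by positivity)]
  congr 1
  ring

theorem exists_eLpNorm_iteratedFDeriv_one_clm_comp_schwartz_sq_le [FiniteDimensional ℝ Y]
    (L : V →L[ℝ] Y) :
    ∃ C : ℝ, 0 ≤ C ∧ ∀ (h : 𝓢(E, V)) (S T : ℝ), (∀ x, ‖h x‖ ≤ S) → 0 ≤ T →
      eLpNorm (fun x => iteratedFDeriv ℝ 2 h x) 2 volume ≤ ENNReal.ofReal T →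
      eLpNorm (fun x => ‖iteratedFDeriv ℝ 1 (fun y => L (h y)) x‖ ^ 2) 2 volume ≤
        ENNReal.ofReal (C * (S * T)) := by
  let b := stdOrthonormalBasis ℝ E
  obtain ⟨ℓ, hℓ⟩ := exists_norm_le_sum_abs_clm Y
  let Q := Fin (Module.finrank ℝ E) × Fin (Module.finrank ℝ Y)
  refine ⟨Fintype.card Q * ∑ q : Q, 3 * ‖ℓ q.2 ∘L L‖ ^ 2, by positivity,
    fun h S T hS hT0 hT => ?_⟩
  have hS0 : 0 ≤ S := (norm_nonneg _).trans (hS 0)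
  have hLh : ContDiff ℝ ∞ fun y => L (h y) := L.contDiff.comp (h.smooth ⊤)
  let D : Q → E → ℝ := fun q x => fderiv ℝ (fun y => (ℓ q.2 ∘L L) (h y)) x (b q.1) ^ 2
  have hD_apply : ∀ q x, D q x = ℓ q.2 (fderiv ℝ (fun y => L (h y)) x (b q.1)) ^ 2 := fun q x => by
    have hd := (hLh.differentiable (by simp)).differentiableAt (x := x)
    have hcomp := ((ℓ q.2).hasFDerivAt.comp x hd.hasFDerivAt).fderiv
    exact congrArg (fun T : E →L[ℝ] ℝ => T (b q.1) ^ 2) hcomp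
  have hD_meas : ∀ q, AEStronglyMeasurable (D q) volume := fun q =>
    ((((((ℓ q.2 ∘L L).contDiff.comp (h.smooth ⊤)).continuous_fderiv (by simp)).clm_apply
      continuous_const).pow 2)).aestronglyMeasurable
  have hD_sum : eLpNorm (∑ q, D q) 2 volume ≤
      ∑ q : Q, ENNReal.ofReal (3 * ‖ℓ q.2 ∘L L‖ ^ 2 * (S * T)) :=
    (eLpNorm_sum_le (fun q _ => hD_meas q) one_le_two).trans (Finset.sum_le_sum fun q _ =>
      eLpNorm_fderiv_clm_comp_schwartz_sq_le (ℓ q.2 ∘L L) h hS hT (b.norm_eq_one q.1))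
  refine (eLpNorm_le_mul_eLpNorm_of_ae_le_mul (g := ∑ q, D q) (c := Fintype.card Q)
    (Eventually.of_forall fun x => ?_) 2).trans ((mul_le_mul_right hD_sum _).trans_eq ?_)
  · rw [Finset.sum_apply, Real.norm_of_nonneg (by positivity), norm_iteratedFDeriv_one]
    refine (norm_clm_sq_le_card_mul_sum_sq b hℓ _).trans ?_
    simp only [hD_apply]
    gcongr
    exact Real.le_norm_self _
  · rw [← ENNReal.ofReal_sum_of_nonneg (fun _ _ => by positivity), ← Finset.sum_mul,
      ← ENNReal.ofReal_mul (by positivity), mul_assoc]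

variable [CompleteSpace V] {m : ℕ}

theorem exists_schwartzBessel_deriv_le (hdim : 2 ≤ m → Module.finrank ℝ E ≤ 3) :
    ∃ C : ℝ, 0 ≤ C ∧ ∀ g : 𝓢(E, V),
      (∀ j ≤ m, eLpNorm (fun x => iteratedFDeriv ℝ j (schwartzBessel (-m) g) x) 2 volume ≤
        ENNReal.ofReal (C * ‖g.toLp 2‖)) ∧
      ∀ j, j + 2 ≤ m → ∀ x, ‖iteratedFDeriv ℝ j (schwartzBessel (-m) g) x‖ ≤ C * ‖g.toLp 2‖ := by
  obtain ⟨C₁, hC₁0, hC₁⟩ := exists_nonneg_forall_of_monotone (m := m)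
    (P := fun j C => ∀ g : 𝓢(E, V), eLpNorm (fun x => iteratedFDeriv ℝ j
      (schwartzBessel (-m) g) x) 2 volume ≤ ENNReal.ofReal (C * ‖g.toLp 2 volume‖))
    (fun j C C' hCC' hC g => (hC g).trans (by gcongr))
    (fun j hj => (exists_eLpNorm_iteratedFDeriv_schwartzBessel_le (Nat.cast_le.2 hj)).imp
      fun _ h => h.2)
  obtain ⟨C₂, -, hC₂⟩ := exists_nonneg_forall_of_monotone (m := m)
    (P := fun j C => j + 2 ≤ m → ∀ (g : 𝓢(E, V)) x,
      ‖iteratedFDeriv ℝ j (schwartzBessel (-m) g) x‖ ≤ C * ‖g.toLp 2 volume‖)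
    (fun j C C' hCC' hC hj g x => (hC hj g x).trans (by gcongr))
    (fun j _ => by
      by_cases hj : j + 2 ≤ m
      · have hE : Module.finrank ℝ E + 2 * j < 2 * m := by have := hdim (by omega); omega
        obtain ⟨C, -, hC⟩ := exists_norm_iteratedFDeriv_schwartzBessel_le (E := E) (V := V)
          (s := m) (j := j) (mod_cast hE)
        exact ⟨C, fun _ => hC⟩
      · exact ⟨0, fun h => absurd h hj⟩)
  refine ⟨max C₁ C₂, hC₁0.trans (le_max_left _ _), fun g => ⟨fun j hj => ?_, fun j hj x => ?_⟩⟩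
  · exact (hC₁ j hj g).trans (by gcongr; exact le_max_left _ _)
  · exact (hC₂ j (by omega) hj g x).trans (by gcongr; exact le_max_right _ _)

variable [FiniteDimensional ℝ Y]

theorem exists_sobolevDerivBound (hdim : 2 ≤ m → Module.finrank ℝ E ≤ 3) (L : V →L[ℝ] Y) :
    ∃ C : ℝ, 0 ≤ C ∧ ∀ g : 𝓢(E, V), SobolevDerivBound m (fun x => L (schwartzBessel (-m) g x))
      (C * ‖g.toLp 2‖) := by
  obtain ⟨A, hA0, hA⟩ := exists_schwartzBessel_deriv_le (V := V) hdim
  obtain ⟨D, -, hD⟩ := exists_eLpNorm_iteratedFDeriv_one_clm_comp_schwartz_sq_le (E := E) L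
  have hLA : ‖L‖ * A ≤ max (‖L‖ * A) √(D * (A * A)) := le_max_left _ _
  have hDA : D * (A * A) ≤ max (‖L‖ * A) √(D * (A * A)) ^ 2 :=
    (Real.sqrt_le_left (by positivity)).1 (le_max_right _ _)
  refine ⟨max (‖L‖ * A) √(D * (A * A)), by positivity, fun g => ?_⟩
  obtain ⟨hA_two, hA_top⟩ := hA g
  exact
    { nonneg := by positivity
      contDiff := L.contDiff.comp ((schwartzBessel (-m) g).smooth ⊤)
      eLpNorm_le := fun j hj => by
        refine (eLpNorm_iteratedFDeriv_clm_comp_schwartz_le L _ j (hA_two j hj)).trans ?_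
        rw [← mul_assoc]
        gcongr
      norm_le := fun j hj x => by
        refine (norm_iteratedFDeriv_clm_comp_schwartz_le L _ j x).trans ?_
        refine (mul_le_mul_of_nonneg_left (hA_top j hj x) (norm_nonneg L)).trans ?_
        rw [← mul_assoc]
        gcongr
      eLpNorm_sq_le := fun hm2 => by
        have hsup : ∀ x, ‖schwartzBessel (-m) g x‖ ≤ A * ‖g.toLp 2‖ := fun x => by
          simpa using hA_top 0 (by omega) x
        refine (hD _ _ _ hsup (by positivity) (hA_two 2 hm2.ge)).trans
          (ENNReal.ofReal_le_ofReal ?_)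
        rw [mul_pow]
        refine le_trans (le_of_eq ?_) (mul_le_mul_of_nonneg_right hDA (by positivity))
        ring }

theorem exists_schwartz_eq_comp_norm_schwartzBessel_le [CompleteSpace W] (hm : 1 ≤ m)
    (hdim : 2 ≤ m → Module.finrank ℝ E ≤ 3) (L : V →L[ℝ] Y) (C : ℝ) :
    ∃ K : ℝ, 0 ≤ K ∧ ∀ G : Y → W, HomogeneousGrowth m C G → G =ᶠ[𝓝 0] 0 → ∀ g : 𝓢(E, V),
      ∃ f : 𝓢(E, W), (∀ x, f x = G (L (schwartzBessel (-m) g x))) ∧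
        ‖(schwartzBessel m f).toLp 2‖ ≤ K * ‖g.toLp 2‖ ^ m := by
  obtain ⟨A, hA0, hA⟩ := exists_sobolevDerivBound (E := E) hdim L
  obtain ⟨N, hN0, hN⟩ := exists_eLpNorm_schwartzBessel_natCast_le (E := E) (V := W) m
  let K := N * (C * A ^ m + Fintype.card (OrderedFinpartition m) * C * A ^ m)
  refine ⟨max K 0, le_max_right _ _, fun G hG hG0 g => ?_⟩
  set h := schwartzBessel (-m) g
  have hC := hG.nonneg
  have hh := hA g
  have hlim : Tendsto (fun x => L (h x)) (cocompact E) (𝓝 0) := by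
    have hL := (L.continuous.tendsto 0).comp (zero_at_infty h)
    rwa [map_zero] at hL
  let f : 𝓢(E, W) := (hasCompactSupport_comp_of_tendsto_cocompact hG0 hlim).toSchwartzMap
    (hG.contDiff.comp hh.contDiff)
  refine ⟨f, fun x => rfl, le_trans ?_ (mul_le_mul_of_nonneg_right (le_max_left K 0)
    (by positivity))⟩
  rw [← ENNReal.ofReal_le_ofReal_iff (by positivity), ofReal_norm_schwartz_toLp]
  refine (hN f).trans ((mul_le_mul_right (add_le_add (hh.eLpNorm_comp_le hm hG)
    (hh.eLpNorm_iteratedFDeriv_comp_le hm hG)) _).trans_eq ?_)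
  rw [← ENNReal.ofReal_add (by positivity) (by positivity), ← ENNReal.ofReal_mul hN0]
  congr 1
  ring

end APriori

section BesselClosure

open TemperedDistribution

variable {E V : Type*} [NormedAddCommGroup E] [InnerProductSpace ℝ E] [FiniteDimensional ℝ E]
  [MeasurableSpace E] [BorelSpace E]

theorem besselSymbol_neg_memLp_top {s : ℝ} (hs : 0 ≤ s) :
    MemLp (fun ξ : E => (besselSymbol (-s) ξ : ℂ)) ∞ volume := by
  refine memLp_top_of_bound
    (besselSymbol_ofReal_hasTemperateGrowth (-s)).1.continuous.aestronglyMeasurable 1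
    (Eventually.of_forall fun ξ => ?_)
  rw [Complex.norm_real, Real.norm_of_nonneg (besselSymbol_pos _ _).le, ← besselSymbol_zero ξ]
  exact besselSymbol_mono (by linarith) ξ

variable [NormedAddCommGroup V] [InnerProductSpace ℂ V] [CompleteSpace V]

theorem toTemperedDistribution_injective :
    Function.Injective fun f : Lp V 2 (volume : Measure E) => (f : 𝓢'(E, V)) :=
  LinearMap.ker_eq_bot.mp (Lp.ker_toTemperedDistributionCLM_eq_bot (E := E) (F := V)
    (μ := (volume : Measure E)) (p := 2))

theorem besselPotential_eq_iff_fourier_ae_eq {s : ℝ} (hs : 0 ≤ s)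
    {f g : Lp V 2 (volume : Measure E)} :
    besselPotential E V s (f : 𝓢'(E, V)) = (g : 𝓢'(E, V)) ↔
      ∀ᵐ ξ, (𝓕 g : Lp V 2 (volume : Measure E)) ξ =
        besselSymbol s ξ • (𝓕 f : Lp V 2 (volume : Measure E)) ξ := by
  let σ : Lp ℂ ∞ (volume : Measure E) := (besselSymbol_neg_memLp_top hs).toLp _
  have hfourier : 𝓕 (besselPotential E V (-s) (g : 𝓢'(E, V))) =
      ((σ • (𝓕 g : Lp V 2 (volume : Measure E)) : Lp V 2 (volume : Measure E)) : 𝓢'(E, V)) := by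
    rw [Lp.toTemperedDistribution_smul_eq (besselSymbol_ofReal_hasTemperateGrowth (-s)),
      fourier_besselPotential_eq_smulLeftCLM_fourier_apply, Lp.fourier_toTemperedDistribution_eq]
    rfl
  have hsmul : ⇑(σ • (𝓕 g : Lp V 2 (volume : Measure E))) =ᵐ[volume]
      fun ξ => besselSymbol (-s) ξ • (𝓕 g : Lp V 2 (volume : Measure E)) ξ := by
    filter_upwards [Lp.coeFn_lpSMul (r := 2) σ (𝓕 g : Lp V 2 (volume : Measure E)),
      (besselSymbol_neg_memLp_top (E := E) hs).coeFn_toLp] with ξ hmul hσ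
    rw [hmul, Pi.smul_apply', hσ, Complex.coe_smul]
  have hcancel : ∀ ξ : E, besselSymbol s ξ * besselSymbol (-s) ξ = 1 := fun ξ => by
    rw [← besselSymbol_add, add_neg_cancel, besselSymbol_zero]
  rw [← besselPotential_neg_apply_eq_iff,
    ← (fourierCLE ℂ 𝓢'(E, V)).injective.eq_iff, fourierCLE_apply, fourierCLE_apply, hfourier,
    Lp.fourier_toTemperedDistribution_eq, toTemperedDistribution_injective.eq_iff,
    Lp.ext_iff]
  refine eventually_congr ?_
  filter_upwards [hsmul] with ξ hξ
  rw [hξ]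
  constructor <;> intro h
  · rw [← h, smul_smul, hcancel, one_smul]
  · rw [h, smul_smul, mul_comm, hcancel, one_smul]

theorem norm_le_of_besselPotential_eq {s : ℝ} (hs : 0 ≤ s) {f g : Lp V 2 (volume : Measure E)}
    (h : besselPotential E V s (f : 𝓢'(E, V)) = (g : 𝓢'(E, V))) : ‖f‖ ≤ ‖g‖ := by
  rw [← Lp.norm_fourier_eq f, ← Lp.norm_fourier_eq g]
  refine Lp.norm_le_norm_of_ae_le ?_
  filter_upwards [(besselPotential_eq_iff_fourier_ae_eq hs).1 h] with ξ hξ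
  rw [hξ, norm_smul, Real.norm_of_nonneg (besselSymbol_pos _ _).le]
  refine le_mul_of_one_le_left (norm_nonneg _) ?_
  rw [← besselSymbol_zero ξ]
  exact besselSymbol_mono hs ξ

theorem besselPotential_toLp_schwartz (s : ℝ) (f : 𝓢(E, V)) :
    besselPotential E V s ((f.toLp 2 : Lp V 2 (volume : Measure E)) : 𝓢'(E, V)) =
      (((schwartzBessel s f).toLp 2 : Lp V 2 (volume : Measure E)) : 𝓢'(E, V)) := by
  rw [besselPotential, Lp.toTemperedDistribution_toLp_eq, Lp.toTemperedDistribution_toLp_eq,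
    fourierMultiplierCLM_toTemperedDistributionCLM_eq (by fun_prop)]
  congr 1
  exact SchwartzMap.fourierMultiplierCLM_ofReal ℂ (besselSymbol_hasTemperateGrowth s) f

theorem exists_schwartz_tendsto_of_besselPotential_eq {s : ℝ} (hs : 0 ≤ s)
    {f g : Lp V 2 (volume : Measure E)}
    (h : besselPotential E V s (f : 𝓢'(E, V)) = (g : 𝓢'(E, V))) :
    ∃ φ : ℕ → 𝓢(E, V), Tendsto (fun k => (φ k).toLp 2) atTop (𝓝 g) ∧
      Tendsto (fun k => (schwartzBessel (-s) (φ k)).toLp 2) atTop (𝓝 f) := by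
  obtain ⟨φ, hφ⟩ : ∃ φ : ℕ → 𝓢(E, V), Tendsto (fun k => (φ k).toLp 2) atTop (𝓝 g) := by
    have hdense := SchwartzMap.denseRange_toLpCLM (E := E) (F := V) (p := 2) (μ := volume)
      ENNReal.ofNat_ne_top g
    obtain ⟨x, hx, hxg⟩ := mem_closure_iff_seq_limit.1 hdense
    choose φ hφ using hx
    exact ⟨φ, hxg.congr fun k => (hφ k).symm⟩
  refine ⟨φ, hφ, ?_⟩
  rw [tendsto_iff_norm_sub_tendsto_zero] at hφ ⊢
  refine squeeze_zero (fun _ => norm_nonneg _) (fun k => norm_le_of_besselPotential_eq hs ?_) hφ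
  have hk := (besselPotential_neg_apply_eq_iff s _ _).1 (besselPotential_toLp_schwartz (-s) (φ k))
  simp only [← Lp.toTemperedDistributionCLM_apply] at h hk ⊢
  rw [map_sub, map_sub, map_sub, h, hk]

theorem exists_ae_tendsto_fourier_of_tendsto {f : ℕ → Lp V 2 (volume : Measure E)}
    {f₀ : Lp V 2 (volume : Measure E)} (hf : Tendsto f atTop (𝓝 f₀)) :
    ∃ ns : ℕ → ℕ, StrictMono ns ∧ ∀ᵐ ξ, Tendsto
      (fun k => (𝓕 (f (ns k)) : Lp V 2 (volume : Measure E)) ξ) atTop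
      (𝓝 ((𝓕 f₀ : Lp V 2 (volume : Measure E)) ξ)) :=
  (tendstoInMeasure_of_tendsto_Lp
    (((Lp.fourierTransformₗᵢ E V).continuous.tendsto f₀).comp hf)).exists_seq_tendsto_ae

theorem exists_besselPotential_eq_of_tendsto {s : ℝ} (hs : 0 ≤ s)
    {f g : ℕ → Lp V 2 (volume : Measure E)} {f₀ : Lp V 2 (volume : Measure E)}
    (hfg : ∀ k, besselPotential E V s (f k : 𝓢'(E, V)) = (g k : 𝓢'(E, V)))
    (hf : Tendsto f atTop (𝓝 f₀)) {M : ℕ → ℝ} {M₀ : ℝ} (hM : Tendsto M atTop (𝓝 M₀))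
    (hgM : ∀ k, ‖g k‖ ≤ M k) :
    ∃ g₀ : Lp V 2 (volume : Measure E),
      besselPotential E V s (f₀ : 𝓢'(E, V)) = (g₀ : 𝓢'(E, V)) ∧ ‖g₀‖ ≤ M₀ := by
  obtain ⟨ns, hns, hae⟩ := exists_ae_tendsto_fourier_of_tendsto hf
  let ĝ : E → V := fun ξ => besselSymbol s ξ • (𝓕 f₀ : Lp V 2 (volume : Measure E)) ξ
  have hlim : ∀ᵐ ξ, Tendsto (fun k => (𝓕 (g (ns k)) : Lp V 2 (volume : Measure E)) ξ) atTop
      (𝓝 (ĝ ξ)) := by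
    filter_upwards [hae,
      ae_all_iff.2 fun k => (besselPotential_eq_iff_fourier_ae_eq hs).1 (hfg k)] with ξ hξ hgξ
    simp only [hgξ]
    exact hξ.const_smul _
  have hfatou : eLpNorm ĝ 2 volume ≤ ENNReal.ofReal M₀ := by
    refine (Lp.eLpNorm_lim_le_liminf_eLpNorm (fun k => Lp.aestronglyMeasurable _) _ hlim).trans ?_
    rw [← (ENNReal.tendsto_ofReal (hM.comp hns.tendsto_atTop)).liminf_eq]
    refine liminf_le_liminf (Eventually.of_forall fun k => ?_)
    rw [← Lp.enorm_def, ← ofReal_norm, Lp.norm_fourier_eq]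
    exact ENNReal.ofReal_le_ofReal (hgM _)
  have hĝ : MemLp ĝ 2 volume :=
    ⟨(besselSymbol_hasTemperateGrowth s).1.continuous.aestronglyMeasurable.smul
      (Lp.aestronglyMeasurable _), hfatou.trans_lt ENNReal.ofReal_lt_top⟩
  have hfourier : 𝓕 (𝓕⁻ (hĝ.toLp ĝ) : Lp V 2 (volume : Measure E)) = hĝ.toLp ĝ :=
    fourier_fourierInv_eq _
  refine ⟨𝓕⁻ (hĝ.toLp ĝ), (besselPotential_eq_iff_fourier_ae_eq hs).2 ?_, ?_⟩
  · rw [hfourier]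
    exact hĝ.coeFn_toLp
  · rw [← Lp.norm_fourier_eq, hfourier, Lp.norm_toLp]
    exact ENNReal.toReal_le_of_le_ofReal
      (ge_of_tendsto' hM fun k => (norm_nonneg _).trans (hgM k)) hfatou

end BesselClosure

section Limit

variable {α Y W : Type*} [MeasurableSpace α] {μ : Measure α} [NormedAddCommGroup Y]
  [NormedAddCommGroup W] {p : ℝ≥0∞}

theorem tendsto_eLpNorm_zero_of_dominated (hp0 : p ≠ 0) (hp : p ≠ ⊤) {f : ℕ → α → W} {b : α → ℝ}
    (hf : ∀ k, AEStronglyMeasurable (f k) μ) (hb : MemLp b p μ)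
    (hle : ∀ k, ∀ᵐ x ∂μ, ‖f k x‖ ≤ b x) (hlim : ∀ᵐ x ∂μ, Tendsto (fun k => f k x) atTop (𝓝 0)) :
    Tendsto (fun k => eLpNorm (f k) p μ) atTop (𝓝 0) := by
  have hp_pos : 0 < p.toReal := ENNReal.toReal_pos hp0 hp
  have hlint : Tendsto (fun k => ∫⁻ x, ‖f k x‖ₑ ^ p.toReal ∂μ) atTop (𝓝 (∫⁻ _, 0 ∂μ)) := by
    refine tendsto_lintegral_of_dominated_convergence' (fun x => ‖b x‖ₑ ^ p.toReal)
      (fun k => (hf k).enorm.pow_const _) (fun k => ?_)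
      (lintegral_rpow_enorm_lt_top_of_eLpNorm_lt_top hp0 hp hb.2).ne ?_
    · filter_upwards [hle k] with x hx
      gcongr
      exact enorm_le_iff_norm_le.2 (hx.trans (Real.le_norm_self _))
    · filter_upwards [hlim] with x hx
      simpa [hp_pos] using hx.enorm.ennrpow_const p.toReal
  simp only [eLpNorm_eq_lintegral_rpow_enorm_toReal hp0 hp]
  simpa [hp_pos] using hlint.ennrpow_const (1 / p.toReal)

theorem ae_mem_of_tendsto_eLpNorm (hp0 : p ≠ 0) {S : Set Y} (hS : IsClosed S) {v : ℕ → α → Y}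
    {u : α → Y} (hv : ∀ k, AEStronglyMeasurable (v k) μ) (hu : AEStronglyMeasurable u μ)
    (hvu : Tendsto (fun k => eLpNorm (v k - u) p μ) atTop (𝓝 0))
    (hvS : ∀ k, ∀ᵐ x ∂μ, v k x ∈ S) : ∀ᵐ x ∂μ, u x ∈ S := by
  obtain ⟨ns, -, hns⟩ :=
    (tendstoInMeasure_of_tendsto_eLpNorm hp0 hv hu hvu).exists_seq_tendsto_ae
  filter_upwards [hns, ae_all_iff.2 hvS] with x hx hxS
  exact hS.mem_of_tendsto hx (Eventually.of_forall fun k => hxS (ns k))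

theorem tendsto_eLpNorm_clm_comp_sub {V : Type*} [NormedAddCommGroup V] [NormedSpace ℝ V]
    [NormedSpace ℝ Y] (L : V →L[ℝ] Y) {h : ℕ → α → V} {f : α → V}
    (hf : Tendsto (fun k => eLpNorm (h k - f) p μ) atTop (𝓝 0)) :
    Tendsto (fun k => eLpNorm (⇑L ∘ h k - ⇑L ∘ f) p μ) atTop (𝓝 0) := by
  have hmul := ENNReal.Tendsto.const_mul hf (Or.inr (ENNReal.ofReal_ne_top (r := ‖L‖)))
  rw [mul_zero] at hmul
  refine tendsto_of_tendsto_of_tendsto_of_le_of_le tendsto_const_nhds hmul (fun _ => zero_le)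
    fun k => eLpNorm_le_mul_eLpNorm_of_ae_le_mul (Eventually.of_forall fun x => ?_) p
  simpa using L.le_opNorm (h k x - f x)

variable [NormedSpace ℝ Y] [NormedSpace ℝ W] {F : Y → W} {C R : ℝ} {m : ℕ}

theorem HomogeneousGrowth.norm_le_mul_norm {G : Y → W} (hG : HomogeneousGrowth m C G)
    (hm : 1 ≤ m) {y : Y} (hy : ‖y‖ ^ (m - 1) ≤ R) : ‖G y‖ ≤ C * R * ‖y‖ := by
  have hC := hG.nonneg
  refine (hG.norm_le y).trans ?_
  rw [← Nat.sub_add_cancel hm, pow_succ, mul_assoc C]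
  gcongr

theorem HomogeneousGrowth.norm_sub_le_mul_norm_sub {G : Y → W} (hG : HomogeneousGrowth m C G)
    (hm : 1 ≤ m) {a b : Y} (ha : ‖a‖ ^ (m - 1) ≤ R) (hb : ‖b‖ ^ (m - 1) ≤ R) :
    ‖G a - G b‖ ≤ C * R * ‖a - b‖ := by
  have hC := hG.nonneg
  refine (hG.norm_sub_le hm a b).trans ?_
  gcongr
  rcases max_choice ‖a‖ ‖b‖ with h | h <;> rwa [h]

variable {G : ℕ → Y → W} {u : α → Y}

theorem aestronglyMeasurable_comp_of_tendsto (hG : ∀ k, HomogeneousGrowth m C (G k))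
    (hGF : ∀ y, Tendsto (fun k => G k y) atTop (𝓝 (F y))) (hu : AEStronglyMeasurable u μ) :
    AEStronglyMeasurable (F ∘ u) μ :=
  aestronglyMeasurable_of_tendsto_ae atTop
    (fun k => (hG k).contDiff.continuous.comp_aestronglyMeasurable hu)
    (Eventually.of_forall fun x => hGF (u x))

theorem memLp_comp_of_tendsto (hm : 1 ≤ m) (hG : ∀ k, HomogeneousGrowth m C (G k))
    (hGF : ∀ y, Tendsto (fun k => G k y) atTop (𝓝 (F y))) (hu : MemLp u p μ)
    (huR : ∀ᵐ x ∂μ, ‖u x‖ ^ (m - 1) ≤ R) : MemLp (F ∘ u) p μ := by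
  refine hu.of_le_mul (c := C * R) (aestronglyMeasurable_comp_of_tendsto hG hGF hu.1) ?_
  filter_upwards [huR] with x hx
  exact le_of_tendsto (hGF (u x)).norm
    (Eventually.of_forall fun k => (hG k).norm_le_mul_norm hm hx)

theorem tendsto_eLpNorm_comp_sub_comp_of_tendsto (hp0 : p ≠ 0) (hp : p ≠ ⊤) (hm : 1 ≤ m)
    (hG : ∀ k, HomogeneousGrowth m C (G k))
    (hGF : ∀ y, Tendsto (fun k => G k y) atTop (𝓝 (F y))) (hu : MemLp u p μ)
    (huR : ∀ᵐ x ∂μ, ‖u x‖ ^ (m - 1) ≤ R) :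
    Tendsto (fun k => eLpNorm (G k ∘ u - F ∘ u) p μ) atTop (𝓝 0) := by
  refine tendsto_eLpNorm_zero_of_dominated hp0 hp (b := fun x => C * R * ‖u x‖ + ‖F (u x)‖)
    (fun k => ((hG k).contDiff.continuous.comp_aestronglyMeasurable hu.1).sub
      (aestronglyMeasurable_comp_of_tendsto hG hGF hu.1))
    ((hu.norm.const_mul _).add (memLp_comp_of_tendsto hm hG hGF hu huR).norm) (fun k => ?_)
    (Eventually.of_forall fun x => ?_)
  · filter_upwards [huR] with x hx
    exact (norm_sub_le _ _).trans (add_le_add_left ((hG k).norm_le_mul_norm hm hx) _)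
  · simpa using (hGF (u x)).sub_const (F (u x))

theorem tendsto_eLpNorm_comp_sub_comp (hp1 : 1 ≤ p) (hp : p ≠ ⊤) (hm : 1 ≤ m)
    (hG : ∀ k, HomogeneousGrowth m C (G k))
    (hGF : ∀ y, Tendsto (fun k => G k y) atTop (𝓝 (F y))) (hu : MemLp u p μ) {v : ℕ → α → Y}
    (hv : ∀ k, AEStronglyMeasurable (v k) μ) (huR : ∀ᵐ x ∂μ, ‖u x‖ ^ (m - 1) ≤ R)
    (hvR : ∀ k, ∀ᵐ x ∂μ, ‖v k x‖ ^ (m - 1) ≤ R)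
    (hvu : Tendsto (fun k => eLpNorm (v k - u) p μ) atTop (𝓝 0)) :
    Tendsto (fun k => eLpNorm (G k ∘ v k - F ∘ u) p μ) atTop (𝓝 0) := by
  have hGc : ∀ k w, AEStronglyMeasurable w μ → AEStronglyMeasurable (G k ∘ w) μ :=
    fun k w hw => (hG k).contDiff.continuous.comp_aestronglyMeasurable hw
  have hGv : ∀ k, eLpNorm (G k ∘ v k - G k ∘ u) p μ ≤
      ENNReal.ofReal (C * R) * eLpNorm (v k - u) p μ := fun k => by
    refine eLpNorm_le_mul_eLpNorm_of_ae_le_mul ?_ p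
    filter_upwards [huR, hvR k] with x hux hvx
    exact (hG k).norm_sub_le_mul_norm_sub hm hvx hux
  have hbound := (ENNReal.Tendsto.const_mul hvu
    (Or.inr (ENNReal.ofReal_ne_top (r := C * R)))).add
      (tendsto_eLpNorm_comp_sub_comp_of_tendsto (one_pos.trans_le hp1).ne' hp hm hG hGF hu huR)
  rw [mul_zero, add_zero] at hbound
  refine tendsto_of_tendsto_of_tendsto_of_le_of_le tendsto_const_nhds hbound (fun _ => zero_le)
    fun k => ?_
  rw [← sub_add_sub_cancel (G k ∘ v k) (G k ∘ u) (F ∘ u)]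
  exact (eLpNorm_add_le ((hGc k _ (hv k)).sub (hGc k _ hu.1)) ((hGc k _ hu.1).sub
    (aestronglyMeasurable_comp_of_tendsto hG hGF hu.1)) hp1).trans (add_le_add_left (hGv k) _)

theorem memLp_comp_and_tendsto_eLpNorm_comp_sub_comp (hp1 : 1 ≤ p) (hp : p ≠ ⊤) (hm : 1 ≤ m)
    (hG : ∀ k, HomogeneousGrowth m C (G k))
    (hGF : ∀ y, Tendsto (fun k => G k y) atTop (𝓝 (F y))) (hu : MemLp u p μ) {v : ℕ → α → Y}
    (hv : ∀ k, AEStronglyMeasurable (v k) μ) (hvR : ∀ k, ∀ᵐ x ∂μ, ‖v k x‖ ^ (m - 1) ≤ R)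
    (hvu : Tendsto (fun k => eLpNorm (v k - u) p μ) atTop (𝓝 0)) :
    MemLp (F ∘ u) p μ ∧ Tendsto (fun k => eLpNorm (G k ∘ v k - F ∘ u) p μ) atTop (𝓝 0) := by
  have huR : ∀ᵐ x ∂μ, ‖u x‖ ^ (m - 1) ≤ R :=
    ae_mem_of_tendsto_eLpNorm (one_pos.trans_le hp1).ne' (S := {y | ‖y‖ ^ (m - 1) ≤ R})
      (isClosed_le (by fun_prop) continuous_const) hv hu.1 hvu hvR
  exact ⟨memLp_comp_of_tendsto hm hG hGF hu huR,
    tendsto_eLpNorm_comp_sub_comp hp1 hp hm hG hGF hu hv huR hvR hvu⟩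

end Limit

section Main

open TemperedDistribution

variable {V Y W : Type*} [NormedAddCommGroup V] [InnerProductSpace ℂ V] [CompleteSpace V]
  [NormedAddCommGroup Y] [NormedSpace ℝ Y] [FiniteDimensional ℝ Y]
  [NormedAddCommGroup W] [InnerProductSpace ℂ W] [CompleteSpace W] {m : ℕ} {F : Y → W}

theorem exists_memLp_comp_besselPotential_le {E : Type*} [NormedAddCommGroup E]
    [InnerProductSpace ℝ E] [FiniteDimensional ℝ E] [MeasurableSpace E] [BorelSpace E]
    (hm : 1 ≤ m) (hdim : 2 ≤ m → Module.finrank ℝ E ≤ 3) (hF : ContDiffOn ℝ ∞ F {0}ᶜ)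
    (hhom : ∀ t : ℝ, 0 ≤ t → ∀ y, F (t • y) = t ^ m • F y) (L : V →L[ℝ] Y) :
    ∃ K : ℝ, 0 ≤ K ∧ ∀ f g : Lp V 2 (volume : Measure E),
      besselPotential E V m (f : 𝓢'(E, V)) = (g : 𝓢'(E, V)) →
        ∃ (hFf : MemLp (F ∘ L ∘ f) 2 volume) (g' : Lp W 2 (volume : Measure E)),
          besselPotential E W m ((hFf.toLp _ : Lp W 2 (volume : Measure E)) : 𝓢'(E, W)) =
            (g' : 𝓢'(E, W)) ∧ ‖g'‖ ≤ K * ‖g‖ ^ m := by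
  obtain ⟨C, G, hG, hG0, hGF⟩ := exists_homogeneousGrowth_tendsto hF (by omega) hhom
  obtain ⟨K, hK0, hK⟩ := exists_schwartz_eq_comp_norm_schwartzBessel_le (W := W) hm hdim L C
  obtain ⟨A, hA0, hA⟩ := exists_sobolevDerivBound hdim L
  refine ⟨K, hK0, fun f g hfg => ?_⟩
  obtain ⟨φ, hφg, hφf⟩ := exists_schwartz_tendsto_of_besselPotential_eq m.cast_nonneg hfg
  obtain ⟨D, hD⟩ := hφg.norm.bddAbove_range
  choose w hw hwK using fun k => hK (G k) (hG k) (hG0 k) (φ k)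
  let v : ℕ → E → Y := fun k => L ∘ schwartzBessel (-m) (φ k)
  have hv_cont : ∀ k, Continuous (v k) := fun k => L.continuous.comp (SchwartzMap.continuous _)
  have hv_le : ∀ k x, ‖v k x‖ ^ (m - 1) ≤ (A * D) ^ (m - 1) := fun k x => by
    refine ((hA (φ k)).norm_pow_le (by omega) x).trans ?_
    gcongr
    exact hD ⟨k, rfl⟩
  have hvf : Tendsto (fun k => eLpNorm (v k - L ∘ f) 2 volume) atTop (𝓝 0) :=
    tendsto_eLpNorm_clm_comp_sub L ((Lp.tendsto_Lp_iff_tendsto_eLpNorm''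
      _ (fun k => (schwartzBessel (-m) (φ k)).memLp 2) f
      (Lp.memLp f)).1 (by rwa [Lp.toLp_coeFn]))
  obtain ⟨hFf, hGv⟩ := memLp_comp_and_tendsto_eLpNorm_comp_sub_comp one_le_two
    ENNReal.ofNat_ne_top hm hG hGF (L.comp_memLp' (Lp.memLp f))
    (fun k => (hv_cont k).aestronglyMeasurable) (fun k => Eventually.of_forall (hv_le k)) hvf
  have hw_lim : Tendsto (fun k => (w k).toLp 2) atTop (𝓝 (hFf.toLp _)) := by
    refine (Lp.tendsto_Lp_iff_tendsto_eLpNorm'' _ (fun k => (w k).memLp 2) _ hFf).2 ?_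
    have hGw : ∀ k, G k ∘ v k = w k := fun k => (funext (hw k)).symm
    simpa only [hGw] using hGv
  exact ⟨hFf, exists_besselPotential_eq_of_tendsto m.cast_nonneg
    (fun k => besselPotential_toLp_schwartz m (w k)) hw_lim ((hφg.norm.pow m).const_mul K) hwK⟩

/-- The coordinatewise real part `ℂᵖ → ℝᵖ`, a left inverse of `complexify` on values. -/
noncomputable def euclideanReCLM (p : ℕ) :
    EuclideanSpace ℂ (Fin p) →L[ℝ] EuclideanSpace ℝ (Fin p) :=
  LinearMap.toContinuousLinearMap
    { toFun := fun z => WithLp.toLp 2 fun i => (z i).re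
      map_add' := fun z w => by ext i; simp
      map_smul' := fun c z => by ext i; simp }

theorem euclideanReCLM_complexify {n p : ℕ}
    (u : EuclideanSpace ℝ (Fin n) → EuclideanSpace ℝ (Fin p)) (x : EuclideanSpace ℝ (Fin n)) :
    euclideanReCLM p (complexify u x) = u x := by
  ext i
  simp [euclideanReCLM, complexify]

theorem mainTheorem6_general {n : ℕ} (hm : 1 ≤ m) (hdim : 2 ≤ m → n ≤ 3)
    (hF : ContDiffOn ℝ ∞ F {0}ᶜ)
    (hhom : ∀ t : ℝ, 0 ≤ t → ∀ y, F (t • y) = t ^ m • F y) (L : V →L[ℝ] Y) :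
    ∃ K : ℝ, 0 < K ∧ ∀ u : EuclideanSpace ℝ (Fin n) → V, MemH m u →
      MemH m (fun x => F (L (u x))) ∧ normH m (fun x => F (L (u x))) ≤ K * normH m u ^ m := by
  obtain ⟨K, hK0, hK⟩ := exists_memLp_comp_besselPotential_le
    (E := EuclideanSpace ℝ (Fin n)) hm (by simpa using hdim) hF hhom L
  refine ⟨K + 1, by positivity, fun u ⟨hu, g, hg⟩ => ?_⟩
  obtain ⟨hFf, g', hg', hle⟩ := hK (hu.toLp u) g hg
  have hae : F ∘ L ∘ hu.toLp u =ᵐ[volume] fun x => F (L (u x)) :=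
    hu.coeFn_toLp.fun_comp (F ∘ L)
  have hFu : MemLp (fun x => F (L (u x))) 2 volume := hFf.ae_eq hae
  rw [MemLp.toLp_congr hFf hFu hae] at hg'
  refine ⟨⟨hFu, g', hg'⟩, ?_⟩
  rw [normH_eq m _ hFu g' hg', normH_eq m u hu g hg]
  exact hle.trans (by gcongr; linarith)

end Main

theorem mainTheorem6 (p m n : ℕ) (hp : 1 ≤ p) (hmn : (2 ≤ m ∧ n ≤ 3) ∨ m = 1)
    (F : EuclideanSpace ℝ (Fin p) → ℂ)
    (hF : ContDiffOn ℝ ∞ F {0}ᶜ)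
    (hhom : ∀ t : ℝ, 0 ≤ t → ∀ y : EuclideanSpace ℝ (Fin p), F (t • y) = (t : ℂ) ^ m * F y) :
    ∃ K : ℝ, 0 < K ∧
      ∀ u : EuclideanSpace ℝ (Fin n) → EuclideanSpace ℝ (Fin p),
        MemH m (complexify u) →
          MemH m (fun x => F (u x)) ∧
          normH m (fun x => F (u x)) ≤ K * normH m (complexify u) ^ m := by
  obtain ⟨K, hK0, hK⟩ := mainTheorem6_general (m := m) (n := n) (by omega) (by omega) hF
    (fun t ht y => by simpa using hhom t ht y) (euclideanReCLM p)
  exact ⟨K, hK0, fun u hu => by simpa only [euclideanReCLM_complexify] using hK _ hu⟩
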